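/- Let $L>0$, $\mu>0$. Let $\mathcal G\subset\mathbb R^2$ be the infinite ladder graph with vertices $M_j^\pm=(j,\pm L/2)$, $j\in\mathbb Z$, vertical edges (rungs) $e_j=\{j\}\times(-L/2,L/2)$ and horizontal edges $(j,j+1)\times\{\pm L/2\}$. Give the rung $e_0$ the weight $w^\mu(e_0)=\mu$ and every other edge $e$ the weight $w^\mu(e)=1$. Let $L_2^\mu(\mathcal G)$ be the Hilbert space of functions $u$ on $\mathcal G$ with $\sum_e w^\mu(e)\|u\|^2_{L_2(e)}<\infty$, and let $\mathcal A^\mu$ be the operator $(\mathcal A^\mu u)_e=-u_e''$ in $L_2^\mu(\mathcal G)$ whose domain consists of the continuous functions $u$ on $\mathcal G$ with $u\in H^2(e)$ for every edge $e$, $\sum_e\|u\|^2_{H^2(e)}<\infty$, and $\sum_{e\ni M}w^\mu(e)\,u_e'(M)=0$ at every vertex $M$, where $u_e'(M)$ is the derivative at $M$ in the direction leaving $M$ along $e$. Let $\mathcal A_s^\mu$ be the restriction of $\mathcal A^\mu$ to the Hilbert space of the functions with $u(x,y)=u(x,-y)$. Its discrete spectrum is the set of isolated points of its spectrum that are eigenvalues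 of finite multiplicity, its essential spectrum is the rest of its spectrum, and a gap of it is a bounded nonempty open interval that contains no point of the essential spectrum and whose two end points belong to the essential spectrum. Every gap considered is written $(\omega_b^2,\omega_t^2)$ with $0\le\omega_b<\omega_t$. Let $\phi_L(\omega)=2/\tan(\omega L/2)$ (with value $0$ where $\cos(\omega L/2)=0$), and let $f^\pm$ be the $\pi$-periodic functions with $f^+(\omega)=\tan(\omega/2)$ and $f^-(\omega)=-1/\tan(\omega/2)$ for $0<\omega<\pi$. A gap $(\omega_b^2,\omega_t^2)$ is * of type (i) if $\pi n<\omega_b<\omega_t<\pi(n+1)$ for some $n\in\mathbb Z$, $\phi_L(\omega_b)=f^+(\omega_b)$ and $\phi_L(\omega_t)=f^-(\omega_t)$; * of type (ii) if $\pi n=\omega_b<\omega_t<\pi(n+1)$ for some $n\in\mathbb Z$, $\phi_L(\omega_b)\le 0$ and $\phi_L(\omega_t)=f^-(\omega_t)$; * of type (iii) if $\pi n<\omega_b<\omega_t=\pi(n+1)$ for some $n\in\mathbb Z$, $\phi_L(\omega_b)=f^+(\omega_b)$ and $\phi_L(\omega_t)\ge 0$. **Theorem.** If $\mu\ge 1$,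 the discrete spectrum of $\mathcal A_s^\mu$ is empty. If $0<\mu<1$ and $(\omega_b^2,\omega_t^2)$ is a gap of $\mathcal A_s^\mu$, then: (a) if the gap is of type (i), $\mathcal A_s^\mu$ has exactly two eigenvalues in it, $\lambda_1=\omega_1^2$ and $\lambda_2=\omega_2^2$ with $\omega_b<\omega_1<\omega_2<\omega_t$, both simple and in the discrete spectrum; (b) if the gap is of type (ii) or (iii), $\mathcal A_s^\mu$ has exactly one eigenvalue in it, $\lambda_1=\omega_1^2$ with $\omega_b<\omega_1<\omega_t$, and it is simple and in the discrete spectrum. -/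

import Mathlib

open Set MeasureTheory

noncomputable section

/-! ### Spectral notions for an unbounded operator -/

section Spectral

variable {E : Type*} [NormedAddCommGroup E] [NormedSpace ℂ E]

/-- `z` is in the resolvent set of `A`: `A - z : D(A) → E` is a bijection with bounded inverse. -/
def IsResolventPoint (A : E →ₗ.[ℂ] E) (z : ℂ) : Prop :=
  ∃ R : E →L[ℂ] E,
    (∀ v : E, ∃ h : R v ∈ A.domain, A ⟨R v, h⟩ - z • R v = v) ∧
    ∀ u : A.domain, R (A u - z • (u : E)) = u

/-- The spectrum of an unbounded operator. -/
def opSpectrum (A : E →ₗ.[ℂ] E) : Set ℂ := {z | ¬ IsResolventPoint A z}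

/-- The eigenspace `{u ∈ D(A) | A u = z u}`. -/
def opEigenspace (A : E →ₗ.[ℂ] E) (z : ℂ) : Submodule ℂ E where
  carrier := {u | ∃ h : u ∈ A.domain, A ⟨u, h⟩ = z • u}
  zero_mem' := ⟨A.domain.zero_mem, by
    rw [smul_zero]; exact A.toFun.map_zero⟩
  add_mem' := by
    rintro u v ⟨hu, hu'⟩ ⟨hv, hv'⟩
    refine ⟨A.domain.add_mem hu hv, ?_⟩
    have := A.map_add ⟨u, hu⟩ ⟨v, hv⟩
    rw [smul_add, ← hu', ← hv', ← this]
    rfl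
  smul_mem' := by
    rintro c u ⟨hu, hu'⟩
    refine ⟨A.domain.smul_mem c hu, ?_⟩
    have := A.map_smul c ⟨u, hu⟩
    rw [smul_comm, ← hu', ← this]
    rfl

/-- The set of all eigenvalues. -/
def pointSpectrum (A : E →ₗ.[ℂ] E) : Set ℂ := {z | opEigenspace A z ≠ ⊥}

/-- `z` is a simple eigenvalue: its eigenspace is one-dimensional. -/
def IsSimpleEigenvalue (A : E →ₗ.[ℂ] E) (z : ℂ) : Prop :=
  Module.finrank ℂ (opEigenspace A z) = 1

/-- The discrete spectrum (of a self-adjoint operator): the isolated points of the spectrum that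
are eigenvalues of finite multiplicity. -/
def discreteSpectrum (A : E →ₗ.[ℂ] E) : Set ℂ :=
  {z | z ∈ opSpectrum A ∧ (∃ ε > 0, ∀ w ∈ opSpectrum A, dist w z < ε → w = z) ∧
    z ∈ pointSpectrum A ∧ FiniteDimensional ℂ (opEigenspace A z)}

/-- The essential spectrum (of a self-adjoint operator): the complement, in the spectrum, of the
discrete spectrum. -/
def essentialSpectrum (A : E →ₗ.[ℂ] E) : Set ℂ := opSpectrum A \ discreteSpectrum A

/-- `(a, b)` is a gap of `A`: a nonempty bounded open interval free of essential spectrum and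
maximal with this property, i.e. its two ends belong to the essential spectrum. -/
def IsSpectralGap (A : E →ₗ.[ℂ] E) (a b : ℝ) : Prop :=
  a < b ∧ (a : ℂ) ∈ essentialSpectrum A ∧ (b : ℂ) ∈ essentialSpectrum A ∧
    ∀ x ∈ Ioo a b, (x : ℂ) ∉ essentialSpectrum A

end Spectral

/-! ### The ladder graph and its weighted `L²` space -/

/-- The edges of the ladder: the rung `{j} × (-L/2, L/2)`, parametrised by `y`, and the rails
`(j, j+1) × {L/2}` (`rail true j`) and `(j, j+1) × {-L/2}` (`rail false j`), parametrised
by `x`. -/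
inductive LadderEdge : Type
  | rung (j : ℤ) : LadderEdge
  | rail (upper : Bool) (j : ℤ) : LadderEdge

namespace LadderEdge

/-- Left end of the parameter interval of an edge. -/
def lo (L : ℝ) : LadderEdge → ℝ
  | rung _ => -(L / 2)
  | rail _ j => (j : ℝ)

/-- Right end of the parameter interval of an edge. -/
def hi (L : ℝ) : LadderEdge → ℝ
  | rung _ => L / 2
  | rail _ j => (j : ℝ) + 1

/-- The weight: `μ` on the rung at `x = 0`, and `1` on all other edges. -/
def weight (μ : ℝ) : LadderEdge → ℝ
  | rung j => if j = 0 then μ else 1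
  | rail _ _ => 1

/-- Lebesgue measure on an edge, multiplied by the weight of the edge. -/
def edgeMeasure (L μ : ℝ) (e : LadderEdge) : Measure ℝ :=
  ENNReal.ofReal (weight μ e) • volume.restrict (Ioo (lo L e) (hi L e))

end LadderEdge

open LadderEdge

/-- The weighted space `L²` of the graph: families `(u_e)` with `u_e ∈ L²(e)` and
`∑ w(e) ‖u_e‖² < ∞`, with the corresponding Hilbert norm. -/
abbrev LadderL2 (L μ : ℝ) : Type :=
  lp (fun e : LadderEdge => Lp ℂ 2 (edgeMeasure L μ e)) 2

/-- The functions `f e` on the edges represent the `L²` element `u`. -/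
def Represents (L μ : ℝ) (u : LadderL2 L μ) (f : LadderEdge → ℝ → ℂ) : Prop :=
  ∀ e, ((u e : Lp ℂ 2 (edgeMeasure L μ e)) : ℝ → ℂ) =ᵐ[edgeMeasure L μ e] f e

/-- On `[a, b]`, `f` is absolutely continuous with integrable derivative `g`. -/
def IsPrimitiveOn (a b : ℝ) (f g : ℝ → ℂ) : Prop :=
  IntervalIntegrable g volume a b ∧ ∀ x ∈ Icc a b, f x = f a + ∫ t in a..x, g t

/-- Continuity at the vertices `(j, ± L/2)`, where the rung `j` meets the rails `j` (on its right)
and `j - 1` (on its left). -/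
def ContinuousAtVertices (L : ℝ) (f : LadderEdge → ℝ → ℂ) : Prop :=
  ∀ j : ℤ,
    (f (rung j) (L / 2) = f (rail true j) j ∧
      f (rung j) (L / 2) = f (rail true (j - 1)) j) ∧
    (f (rung j) (-(L / 2)) = f (rail false j) j ∧
      f (rung j) (-(L / 2)) = f (rail false (j - 1)) j)

/-- Kirchhoff's conditions for the edgewise derivatives `f'`: at every vertex `(j, ± L/2)` the sum
over the three adjacent edges of weight times derivative in the direction leaving the vertex
vanishes. -/
def KirchhoffAtVertices (L μ : ℝ) (f' : LadderEdge → ℝ → ℂ) : Prop :=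
  ∀ j : ℤ,
    ((weight μ (rung j) : ℂ) * (-f' (rung j) (L / 2))
      + (weight μ (rail true j) : ℂ) * f' (rail true j) j
      + (weight μ (rail true (j - 1)) : ℂ) * (-f' (rail true (j - 1)) j) = 0) ∧
    ((weight μ (rung j) : ℂ) * f' (rung j) (-(L / 2))
      + (weight μ (rail false j) : ℂ) * f' (rail false j) j
      + (weight μ (rail false (j - 1)) : ℂ) * (-f' (rail false (j - 1)) j) = 0)

/-- `u` lies in the domain of the ladder operator and `v = -u''`: `u` has a representative `f` that
is `H²` on every edge, with derivatives `f'` and `f''`, such that `f`, `f'`, `f''` are all square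
integrable over the graph, `f` is continuous on the graph and `f'` satisfies Kirchhoff's
conditions; and `v` is represented by `-f''`. -/
structure IsLadderPair (L μ : ℝ) (u v : LadderL2 L μ)
    (f f' f'' : LadderEdge → ℝ → ℂ) : Prop where
  rep : Represents L μ u f
  rep_deriv : ∃ u' : LadderL2 L μ, Represents L μ u' f'
  rep_second : Represents L μ v (fun e x => -f'' e x)
  prim : ∀ e, IsPrimitiveOn (lo L e) (hi L e) (f e) (f' e)
  prim' : ∀ e, IsPrimitiveOn (lo L e) (hi L e) (f' e) (f'' e)
  cont : ContinuousAtVertices L f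
  kirchhoff : KirchhoffAtVertices L μ f'

theorem Represents.add {L μ : ℝ} {u v : LadderL2 L μ} {f g : LadderEdge → ℝ → ℂ}
    (hu : Represents L μ u f) (hv : Represents L μ v g) :
    Represents L μ (u + v) (fun e x => f e x + g e x) := by
  intro e
  have h : (u + v : LadderL2 L μ) e = u e + v e := rfl
  rw [h]
  filter_upwards [Lp.coeFn_add (u e) (v e), hu e, hv e] with x h1 h2 h3
  rw [h1, Pi.add_apply, h2, h3]

theorem Represents.smul {L μ : ℝ} {u : LadderL2 L μ} {f : LadderEdge → ℝ → ℂ} (c : ℂ)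
    (hu : Represents L μ u f) : Represents L μ (c • u) (fun e x => c * f e x) := by
  intro e
  have h : (c • u : LadderL2 L μ) e = c • u e := rfl
  rw [h]
  filter_upwards [Lp.coeFn_smul c (u e), hu e] with x h1 h2
  rw [h1, Pi.smul_apply, h2, smul_eq_mul]

theorem Represents.zero {L μ : ℝ} :
    Represents L μ (0 : LadderL2 L μ) (fun _ _ => 0) := by
  intro e
  exact Lp.coeFn_zero ℂ 2 (edgeMeasure L μ e)

theorem IsPrimitiveOn.add {a b : ℝ} {f g f₁ g₁ : ℝ → ℂ} (h : IsPrimitiveOn a b f g)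
    (h₁ : IsPrimitiveOn a b f₁ g₁) :
    IsPrimitiveOn a b (fun x => f x + f₁ x) (fun x => g x + g₁ x) := by
  refine ⟨h.1.add h₁.1, fun x hx => ?_⟩
  have hs : uIcc a x ⊆ uIcc a b := by
    rw [uIcc_of_le hx.1, uIcc_of_le (hx.1.trans hx.2)]
    exact Icc_subset_Icc_right hx.2
  dsimp only
  rw [intervalIntegral.integral_add (h.1.mono_set hs) (h₁.1.mono_set hs), h.2 x hx, h₁.2 x hx]
  ring

theorem IsPrimitiveOn.smul {a b : ℝ} {f g : ℝ → ℂ} (c : ℂ) (h : IsPrimitiveOn a b f g) :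
    IsPrimitiveOn a b (fun x => c * f x) (fun x => c * g x) := by
  refine ⟨h.1.const_mul c, fun x hx => ?_⟩
  dsimp only
  rw [intervalIntegral.integral_const_mul, h.2 x hx]
  ring

/-- The graph of the ladder operator, as a subspace of pairs `(u, -u'')`. -/
def ladderOpGraph (L μ : ℝ) : Submodule ℂ (LadderL2 L μ × LadderL2 L μ) where
  carrier := {p | ∃ f f' f'', IsLadderPair L μ p.1 p.2 f f' f''}
  zero_mem' := by
    refine ⟨fun _ _ => 0, fun _ _ => 0, fun _ _ => 0, Represents.zero, ⟨0, Represents.zero⟩, ?_,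
      ?_, ?_, ?_, ?_⟩
    · simpa using Represents.zero
    · intro e; simp [IsPrimitiveOn]
    · intro e; simp [IsPrimitiveOn]
    · intro j; simp
    · intro j; simp
  add_mem' := by
    rintro p q ⟨f, f', f'', h⟩ ⟨g, g', g'', k⟩
    obtain ⟨u', hu'⟩ := h.rep_deriv
    obtain ⟨v', hv'⟩ := k.rep_deriv
    refine ⟨fun e x => f e x + g e x, fun e x => f' e x + g' e x, fun e x => f'' e x + g'' e x,
      h.rep.add k.rep, ⟨u' + v', hu'.add hv'⟩, ?_, fun e => (h.prim e).add (k.prim e),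
      fun e => (h.prim' e).add (k.prim' e), ?_, ?_⟩
    · have := h.rep_second.add k.rep_second
      simp only [neg_add]
      exact this
    · intro j
      obtain ⟨⟨h1, h2⟩, h3, h4⟩ := h.cont j
      obtain ⟨⟨k1, k2⟩, k3, k4⟩ := k.cont j
      refine ⟨⟨?_, ?_⟩, ?_, ?_⟩ <;> dsimp only
      · rw [h1, k1]
      · rw [h2, k2]
      · rw [h3, k3]
      · rw [h4, k4]
    · intro j
      obtain ⟨h1, h2⟩ := h.kirchhoff j
      obtain ⟨k1, k2⟩ := k.kirchhoff j
      refine ⟨?_, ?_⟩ <;> dsimp only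
      · linear_combination h1 + k1
      · linear_combination h2 + k2
  smul_mem' := by
    rintro c p ⟨f, f', f'', h⟩
    obtain ⟨u', hu'⟩ := h.rep_deriv
    refine ⟨fun e x => c * f e x, fun e x => c * f' e x, fun e x => c * f'' e x,
      h.rep.smul c, ⟨c • u', hu'.smul c⟩, ?_, fun e => (h.prim e).smul c,
      fun e => (h.prim' e).smul c, ?_, ?_⟩
    · have := h.rep_second.smul c
      simp only [mul_neg] at this
      exact this
    · intro j
      obtain ⟨⟨h1, h2⟩, h3, h4⟩ := h.cont j
      refine ⟨⟨?_, ?_⟩, ?_, ?_⟩ <;> dsimp only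
      · rw [h1]
      · rw [h2]
      · rw [h3]
      · rw [h4]
    · intro j
      obtain ⟨h1, h2⟩ := h.kirchhoff j
      refine ⟨?_, ?_⟩ <;> dsimp only
      · linear_combination c * h1
      · linear_combination c * h2

/-- The (unbounded) ladder operator on `L²` of the graph: `u ↦ -u''` on every edge, with
continuity and Kirchhoff's conditions at the vertices. -/
def ladderOp (L μ : ℝ) : LadderL2 L μ →ₗ.[ℂ] LadderL2 L μ :=
  (ladderOpGraph L μ).toLinearPMap

/-! ### The part of the ladder operator in the symmetric subspace -/

/-- The subspace of functions with `u (x, y) = u (x, -y)`: `u` has a representative that is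
invariant under the reflection. -/
def ladderSym (L μ : ℝ) : Submodule ℂ (LadderL2 L μ) where
  carrier := {u | ∃ f, Represents L μ u f ∧ (∀ j y, f (rung j) (-y) = f (rung j) y) ∧
    ∀ j x, f (rail true j) x = f (rail false j) x}
  zero_mem' := ⟨fun _ _ => 0, Represents.zero, by simp, by simp⟩
  add_mem' := by
    rintro u v ⟨f, hf, h1, h2⟩ ⟨g, hg, k1, k2⟩
    refine ⟨fun e x => f e x + g e x, hf.add hg, fun j y => ?_, fun j x => ?_⟩
    · dsimp only; rw [h1, k1]
    · dsimp only; rw [h2, k2]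
  smul_mem' := by
    rintro c u ⟨f, hf, h1, h2⟩
    refine ⟨fun e x => c * f e x, hf.smul c, fun j y => ?_, fun j x => ?_⟩
    · dsimp only; rw [h1]
    · dsimp only; rw [h2]

/-- The graph of the symmetric part: pairs of symmetric functions in the graph of the ladder
operator. -/
def ladderSymOpGraph (L μ : ℝ) : Submodule ℂ (ladderSym L μ × ladderSym L μ) :=
  (ladderOpGraph L μ).comap ((ladderSym L μ).subtype.prodMap (ladderSym L μ).subtype)

/-- The symmetric graph operator: the restriction of the ladder operator to the Hilbert space of
symmetric functions. -/
def ladderSymOp (L μ : ℝ) : ladderSym L μ →ₗ.[ℂ] ladderSym L μ :=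
  (ladderSymOpGraph L μ).toLinearPMap

/-! ### `-u''` is determined by `u`, so that the two graphs above are graphs of operators -/

theorem ae_edge {L μ : ℝ} (hμ : 0 < μ) {e : LadderEdge} {f g : ℝ → ℂ}
    (h : f =ᵐ[edgeMeasure L μ e] g) :
    f =ᵐ[volume.restrict (Ioo (lo L e) (hi L e))] g := by
  have hw : ENNReal.ofReal (weight μ e) ≠ 0 := by
    have : 0 < weight μ e := by
      cases e with
      | rung j => by_cases hj : j = 0 <;> simp [weight, hj, hμ]
      | rail b j => simp [weight]
    simpa using this
  rw [edgeMeasure] at h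
  exact (Measure.ae_ennreal_smul_measure_iff hw).1 h

theorem lo_lt_hi {L : ℝ} (hL : 0 < L) (e : LadderEdge) : lo L e < hi L e := by
  cases e <;> simp [lo, hi]
  linarith

theorem IsPrimitiveOn.continuousOn {a b : ℝ} {f g : ℝ → ℂ} (hab : a ≤ b)
    (h : IsPrimitiveOn a b f g) : ContinuousOn f (Icc a b) := by
  have h1 : ContinuousOn (fun x => ∫ t in a..x, g t) (Icc a b) := by
    rw [← uIcc_of_le hab]
    apply intervalIntegral.continuousOn_primitive_interval
    exact (intervalIntegrable_iff' (by simp)).1 h.1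
  exact (continuousOn_const.add h1).congr h.2

/-- A primitive determines the integrable function it is a primitive of. -/
theorem IsPrimitiveOn.ae_zero {a b : ℝ} {f g : ℝ → ℂ} (hab : a < b)
    (h : IsPrimitiveOn a b f g) (hf : ∀ x ∈ Icc a b, f x = 0) :
    g =ᵐ[volume.restrict (Ioo a b)] fun _ => 0 := by
  have hint : ∀ x ∈ Icc a b, ∫ t in a..x, g t = 0 := by
    intro x hx
    have := h.2 x hx
    rw [hf x hx, hf a ⟨le_rfl, hab.le⟩, zero_add] at this
    exact this.symm
  rw [Filter.EventuallyEq, ae_restrict_iff' measurableSet_Ioo]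
  filter_upwards [h.1.ae_hasDerivAt_integral] with x hx hxI
  have hx' : x ∈ uIcc a b := by
    rw [uIcc_of_le hab.le]
    exact Ioo_subset_Icc_self hxI
  have h1 := hx hx' a left_mem_uIcc
  have h2 : HasDerivAt (fun y => ∫ t in a..y, g t) 0 x := by
    refine (hasDerivAt_const x (0 : ℂ)).congr_of_eventuallyEq ?_
    filter_upwards [Ioo_mem_nhds hxI.1 hxI.2] with y hy
    exact hint y (Ioo_subset_Icc_self hy)
  exact h1.unique h2

theorem eqOn_zero_of_ae_zero {a b : ℝ} {f : ℝ → ℂ} (hab : a < b)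
    (hf : ContinuousOn f (Icc a b)) (h : f =ᵐ[volume.restrict (Ioo a b)] fun _ => 0) :
    ∀ x ∈ Icc a b, f x = 0 := by
  have h' : f =ᵐ[volume.restrict (Icc a b)] fun _ => 0 := by
    rwa [← restrict_Ioo_eq_restrict_Icc]
  exact Measure.eqOn_Icc_of_ae_eq volume hab.ne h' hf continuousOn_const

theorem ladderOpGraph_functional {L μ : ℝ} (hL : 0 < L) (hμ : 0 < μ)
    (p : LadderL2 L μ × LadderL2 L μ) (hp : p ∈ ladderOpGraph L μ) (h0 : p.1 = 0) :
    p.2 = 0 := by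
  obtain ⟨f, f', f'', h⟩ := hp
  refine lp.ext (funext fun e => ?_)
  have hlt := lo_lt_hi hL e
  have hf : f e =ᵐ[volume.restrict (Ioo (lo L e) (hi L e))] fun _ => 0 := by
    refine ae_edge hμ ?_
    have h1 := h.rep e
    rw [h0] at h1
    exact h1.symm.trans (Represents.zero e)
  have hf0 := eqOn_zero_of_ae_zero hlt ((h.prim e).continuousOn hlt.le) hf
  have hf1 := eqOn_zero_of_ae_zero hlt ((h.prim' e).continuousOn hlt.le)
    ((h.prim e).ae_zero hlt hf0)
  have hf2 := (h.prim' e).ae_zero hlt hf1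
  have hf3 : f'' e =ᵐ[edgeMeasure L μ e] fun _ => 0 :=
    Measure.smul_absolutelyContinuous.ae_eq hf2
  refine Lp.ext ?_
  refine (h.rep_second e).trans (Filter.EventuallyEq.trans ?_ (Represents.zero e).symm)
  filter_upwards [hf3] with x hx
  simp [hx]

theorem ladderOp_graph {L μ : ℝ} (hL : 0 < L) (hμ : 0 < μ) :
    (ladderOp L μ).graph = ladderOpGraph L μ :=
  Submodule.toLinearPMap_graph_eq _ (fun p hp h0 => ladderOpGraph_functional hL hμ p hp h0)

theorem ladderSymOp_graph {L μ : ℝ} (hL : 0 < L) (hμ : 0 < μ) :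
    (ladderSymOp L μ).graph = ladderSymOpGraph L μ := by
  refine Submodule.toLinearPMap_graph_eq _ (fun p hp h0 => ?_)
  have := ladderOpGraph_functional hL hμ _ hp (by simp [h0])
  simpa using this

/-! ### The three types of gaps -/

/-- `φ_L(ω) = 2 / tan(ω L / 2)`. -/
def phiL (L ω : ℝ) : ℝ := 2 / Real.tan (ω * L / 2)

/-- The representative of `ω` modulo `π` in `[0, π)`. -/
def modPi (ω : ℝ) : ℝ := ω - Real.pi * ⌊ω / Real.pi⌋

/-- The `π`-periodic function equal to `tan(ω/2)` on `[0, π)`. -/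
def fPlus (ω : ℝ) : ℝ := Real.tan (modPi ω / 2)

/-- The `π`-periodic function equal to `-1 / tan(ω/2)` on `(0, π)`. -/
def fMinus (ω : ℝ) : ℝ := -(Real.tan (modPi ω / 2))⁻¹

/-- Type (i): both ends inside one interval `(π n, π (n+1))`. -/
def IsTypeI (L ωb ωt : ℝ) : Prop :=
  ∃ n : ℤ, Real.pi * n < ωb ∧ ωb < ωt ∧ ωt < Real.pi * (n + 1) ∧
    phiL L ωb = fPlus ωb ∧ phiL L ωt = fMinus ωt

/-- Type (ii): the lower end is a multiple of `π`. -/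
def IsTypeII (L ωb ωt : ℝ) : Prop :=
  ∃ n : ℤ, Real.pi * n = ωb ∧ ωb < ωt ∧ ωt < Real.pi * (n + 1) ∧
    phiL L ωb ≤ 0 ∧ phiL L ωt = fMinus ωt

/-- Type (iii): the upper end is a multiple of `π`. -/
def IsTypeIII (L ωb ωt : ℝ) : Prop :=
  ∃ n : ℤ, Real.pi * n < ωb ∧ ωb < ωt ∧ ωt = Real.pi * (n + 1) ∧
    phiL L ωb = fPlus ωb ∧ 0 ≤ phiL L ωt

end

noncomputable section

open LadderEdge

/-! Put z = ω². A symmetric solution of −u'' = ω²u is a multiple of cos(ωy) on each rung. If sin ω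
and cos(ωL/2) do not vanish, it is determined by its vertex values a_j, and continuity with
Kirchhoff's conditions becomes a_{j+1} + a_{j−1} = 2 g_w a_j, where g_w = cos ω − (w/2) sin ω
tan(ωL/2), with w = μ at j = 0 and w = 1 elsewhere. Square integrability forces a_j → 0, hence a_j =
κ^|j| a_0 with |κ| < 1 and κ² − 2 g_1 κ + 1 = 0, and the equation at the centre says κ = g_μ. So ω²
is an eigenvalue iff |g_μ| < 1 and g_μ² − 2 g_1 g_μ + 1 = 0 (`IsLadderEigenfunction.dispersion`,
`mem_pointSpectrum_of_dispersion`). An energy flux argument excludes every z that is not a positive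
real; the exceptional ω carry no eigenfunction or an infinite-dimensional eigenspace.

For μ ≥ 1 the inequality and the equation are incompatible (`dispersion_impossible`); for μ < 1 the
equation implies the inequality (`dispersion_holds`). With φ = 2 cot(ωL/2) and a = 1 − (1 − μ)² the
equation reads φ² + 2φ cot ω = a, cleared of denominators `gapFun L a ω = 0`. For a = 1 it factors
as (φ − f⁺)(φ − f⁻) = 0, which describes the nondegenerate gap ends.

The bands |g_1| ≤ 1 lie in the essential spectrum (`mem_essentialSpectrum_of_band`), so sin ω ·
`gapFun L 1 ω` < 0 in a gap. There φ + 2 cot ω = a/φ has a decreasing left side and, while φ keeps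
its sign, an increasing right side: at most one zero for each sign of φ (`gapFun_zero_unique`).
Zeros exist by the intermediate value theorem: sin ω · `gapFun L a ω` is positive at an end with φ =
f^±, negative at a zero of φ and next to a degenerate end. In a gap of type (i) φ takes both signs,
of type (ii) only the negative one, of type (iii) only the positive one. -/

/-! ### Calculus on a single edge. -/

theorem IsPrimitiveOn.hasDerivAt {a b : ℝ} {f g : ℝ → ℂ} (h : IsPrimitiveOn a b f g)
    (hg : ContinuousOn g (Icc a b)) {x : ℝ} (hx : x ∈ Ioo a b) : HasDerivAt f (g x) x := by
  have hI : IntervalIntegrable g volume a x := by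
    apply h.1.mono_set
    rw [uIcc_of_le hx.1.le, uIcc_of_le (hx.1.trans hx.2).le]
    exact Icc_subset_Icc_right hx.2.le
  have hc : ContinuousAt g x := hg.continuousAt (Icc_mem_nhds hx.1 hx.2)
  have hm : StronglyMeasurableAtFilter g (nhds x) volume :=
    (hg.mono Ioo_subset_Icc_self).stronglyMeasurableAtFilter isOpen_Ioo x hx
  have h1 := (intervalIntegral.integral_hasDerivAt_right hI hm hc).const_add (f a)
  refine h1.congr_of_eventuallyEq ?_
  filter_upwards [Icc_mem_nhds hx.1 hx.2] with y hy
  exact h.2 y hy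

/-- Lets f'', known only almost everywhere, be replaced by the continuous −z f, so that weak
solutions become classical ones. -/
theorem IsPrimitiveOn.congr_ae {a b : ℝ} {f g k : ℝ → ℂ} (hab : a ≤ b)
    (h : IsPrimitiveOn a b f g) (hgk : g =ᵐ[volume.restrict (Ioo a b)] k) :
    IsPrimitiveOn a b f k := by
  have h' : ∀ x ∈ Icc a b, g =ᵐ[volume.restrict (uIoc a x)] k := by
    intro x hx
    rw [uIoc_of_le hx.1]
    rw [restrict_Ioo_eq_restrict_Ioc] at hgk
    exact ae_restrict_of_ae_restrict_of_subset (Ioc_subset_Ioc_right hx.2) hgk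
  refine ⟨h.1.congr_ae (h' b ⟨hab, le_rfl⟩), fun x hx => ?_⟩
  rw [h.2 x hx]
  congr 1
  apply intervalIntegral.integral_congr_ae_restrict
  exact h' x hx

theorem isPrimitiveOn_of_hasDerivAt {a b : ℝ} {f g : ℝ → ℂ} (hg : Continuous g)
    (h : ∀ x, HasDerivAt f (g x) x) : IsPrimitiveOn a b f g := by
  refine ⟨hg.intervalIntegrable a b, fun x _ => ?_⟩
  rw [intervalIntegral.integral_eq_sub_of_hasDerivAt (fun y _ => h y) (hg.intervalIntegrable a x)]
  ring

theorem eq_left_of_hasDerivAt_zero {a b : ℝ} {F : ℝ → ℂ} (hF : ContinuousOn F (Icc a b))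
    (h : ∀ x ∈ Ioo a b, HasDerivAt F 0 x) : ∀ x ∈ Icc a b, F x = F a := by
  intro x hx
  have h1 := intervalIntegral.integral_eq_sub_of_hasDerivAt_of_le hx.1
    (hF.mono (Icc_subset_Icc_right hx.2)) (f' := fun _ => 0)
    (fun y hy => h y ⟨hy.1, hy.2.trans_le hx.2⟩) (by simp)
  simp only [intervalIntegral.integral_zero] at h1
  exact (sub_eq_zero.1 h1.symm)

/-- The function `f'` is the derivative of `f` and `f'' = -z f` on `[a, b]`. -/
structure IsHelmholtzOn (z : ℂ) (a b : ℝ) (f f' : ℝ → ℂ) : Prop where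
  prim : IsPrimitiveOn a b f f'
  prim' : IsPrimitiveOn a b f' (fun x => -z * f x)

namespace IsHelmholtzOn

variable {z : ℂ} {a b : ℝ} {f f' : ℝ → ℂ}

theorem continuousOn (h : IsHelmholtzOn z a b f f') (hab : a ≤ b) : ContinuousOn f (Icc a b) :=
  h.prim.continuousOn hab

theorem continuousOn' (h : IsHelmholtzOn z a b f f') (hab : a ≤ b) : ContinuousOn f' (Icc a b) :=
  h.prim'.continuousOn hab

theorem hasDerivAt (h : IsHelmholtzOn z a b f f') {x : ℝ} (hx : x ∈ Ioo a b) :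
    HasDerivAt f (f' x) x :=
  h.prim.hasDerivAt (h.continuousOn' (hx.1.trans hx.2).le) hx

theorem hasDerivAt' (h : IsHelmholtzOn z a b f f') {x : ℝ} (hx : x ∈ Ioo a b) :
    HasDerivAt f' (-z * f x) x :=
  h.prim'.hasDerivAt (continuousOn_const.mul (h.continuousOn (hx.1.trans hx.2).le)) hx

/-- Integration of (f̄ f')' = |f'|² − z|f|². Only f is conjugated, so z may be any complex number.
-/
theorem energy (h : IsHelmholtzOn z a b f f') (hab : a ≤ b) :
    (starRingEnd ℂ) (f b) * f' b - (starRingEnd ℂ) (f a) * f' a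
      = ∫ x in a..b, (((‖f' x‖ ^ 2 : ℝ) : ℂ) - z * ((‖f x‖ ^ 2 : ℝ) : ℂ)) := by
  have hc := h.continuousOn hab
  have hc' := h.continuousOn' hab
  refine (intervalIntegral.integral_eq_sub_of_hasDerivAt_of_le hab
    (f := fun x => (starRingEnd ℂ) (f x) * f' x) ?_ ?_ ?_).symm
  · exact (Complex.continuous_conj.comp_continuousOn hc).mul hc'
  · intro x hx
    have h1 : HasDerivAt (fun y => (starRingEnd ℂ) (f y)) ((starRingEnd ℂ) (f' x)) x :=
      (h.hasDerivAt hx).star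
    refine (h1.mul (h.hasDerivAt' hx)).congr_deriv ?_
    push_cast
    rw [← Complex.conj_mul', ← Complex.conj_mul']
    ring
  · apply ContinuousOn.intervalIntegrable
    rw [uIcc_of_le hab]
    fun_prop

/-- The explicit solution of `f'' = -ω² f`. -/
theorem eq_cos_sin {ω : ℝ} (hω : ω ≠ 0) (h : IsHelmholtzOn ((ω ^ 2 : ℝ) : ℂ) a b f f')
    (hab : a ≤ b) {x : ℝ} (hx : x ∈ Icc a b) :
    f x = f a * Real.cos (ω * (x - a)) + f' a / ω * Real.sin (ω * (x - a)) ∧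
      f' x = -ω * f a * Real.sin (ω * (x - a)) + f' a * Real.cos (ω * (x - a)) := by
  have hc := h.continuousOn hab
  have hc' := h.continuousOn' hab
  have hlin : ∀ y : ℝ, HasDerivAt (fun y : ℝ => ω * (y - a)) ω y := fun y => by
    simpa using ((hasDerivAt_id y).sub_const a).const_mul ω
  have hcos : ∀ y : ℝ, HasDerivAt (fun y : ℝ => ((Real.cos (ω * (y - a)) : ℝ) : ℂ))
      ((-Real.sin (ω * (y - a)) * ω : ℝ) : ℂ) y := fun y => (hlin y).cos.ofReal_comp
  have hsin : ∀ y : ℝ, HasDerivAt (fun y : ℝ => ((Real.sin (ω * (y - a)) : ℝ) : ℂ))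
      ((Real.cos (ω * (y - a)) * ω : ℝ) : ℂ) y := fun y => (hlin y).sin.ofReal_comp
  -- Rotating (ω f, f') back by the angle ω(y − a) gives two conserved quantities; this replaces a
  -- uniqueness theorem for the differential equation.
  have hA := eq_left_of_hasDerivAt_zero (a := a) (b := b)
    (F := fun y => ω * f y * ((Real.cos (ω * (y - a)) : ℝ) : ℂ)
      - f' y * ((Real.sin (ω * (y - a)) : ℝ) : ℂ)) (by fun_prop) (fun y hy => by
      refine ((((h.hasDerivAt hy).const_mul (ω : ℂ)).mul (hcos y)).sub
        ((h.hasDerivAt' hy).mul (hsin y))).congr_deriv ?_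
      push_cast
      ring) x hx
  have hB := eq_left_of_hasDerivAt_zero (a := a) (b := b)
    (F := fun y => ω * f y * ((Real.sin (ω * (y - a)) : ℝ) : ℂ)
      + f' y * ((Real.cos (ω * (y - a)) : ℝ) : ℂ)) (by fun_prop) (fun y hy => by
      refine ((((h.hasDerivAt hy).const_mul (ω : ℂ)).mul (hsin y)).add
        ((h.hasDerivAt' hy).mul (hcos y))).congr_deriv ?_
      push_cast
      ring) x hx
  simp only [sub_self, mul_zero, Real.cos_zero, Real.sin_zero, Complex.ofReal_one,
    Complex.ofReal_zero, mul_one, sub_zero, zero_add] at hA hB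
  have hω' : (ω : ℂ) ≠ 0 := by exact_mod_cast hω
  have hcs : ((Real.cos (ω * (x - a)) : ℝ) : ℂ) ^ 2 + ((Real.sin (ω * (x - a)) : ℝ) : ℂ) ^ 2 = 1 := by
    exact_mod_cast Real.cos_sq_add_sin_sq (ω * (x - a))
  constructor
  · apply mul_left_cancel₀ hω'
    field_simp
    linear_combination ((Real.cos (ω * (x - a)) : ℝ) : ℂ) * hA
      + ((Real.sin (ω * (x - a)) : ℝ) : ℂ) * hB - ω * f x * hcs
  · linear_combination -((Real.sin (ω * (x - a)) : ℝ) : ℂ) * hA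
      + ((Real.cos (ω * (x - a)) : ℝ) : ℂ) * hB - f' x * hcs

end IsHelmholtzOn

/-! ### Traces at the vertices and their decay. -/

theorem edgeMeasure_rail (L μ : ℝ) (b : Bool) (j : ℤ) :
    edgeMeasure L μ (rail b j) = volume.restrict (Ioo (j : ℝ) (j + 1)) := by
  simp [edgeMeasure, weight, lo, hi]

instance isProbabilityMeasure_edgeMeasure_rail (L μ : ℝ) (b : Bool) (j : ℤ) :
    IsProbabilityMeasure (edgeMeasure L μ (rail b j)) := by
  rw [edgeMeasure_rail]
  constructor
  simp

/-- A rail has total mass one, so its L¹ norm is at most its L² norm. -/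
theorem setIntegral_norm_le_of_represents {L μ : ℝ} {u : LadderL2 L μ} {f : LadderEdge → ℝ → ℂ}
    (h : Represents L μ u f) (b : Bool) (j : ℤ) :
    IntegrableOn (f (rail b j)) (Ioo (j : ℝ) (j + 1)) ∧
      ∫ x in Ioo (j : ℝ) (j + 1), ‖f (rail b j) x‖ ≤ ‖u (rail b j)‖ := by
  set e := rail b j
  have hm : MemLp (f e) 2 (edgeMeasure L μ e) := (memLp_congr_ae (h e)).1 (Lp.memLp (u e))
  have h1 : MemLp (f e) 1 (edgeMeasure L μ e) := hm.mono_exponent (by norm_num)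
  have hint : Integrable (f e) (edgeMeasure L μ e) := memLp_one_iff_integrable.1 h1
  have hle : eLpNorm (f e) 1 (edgeMeasure L μ e) ≤ eLpNorm (f e) 2 (edgeMeasure L μ e) :=
    eLpNorm_le_eLpNorm_of_exponent_le (by norm_num) hm.1
  have hn : ‖u e‖ = (eLpNorm (f e) 2 (edgeMeasure L μ e)).toReal := by
    rw [Lp.norm_def, eLpNorm_congr_ae (h e)]
  have hi : ∫ x, ‖f e x‖ ∂(edgeMeasure L μ e) = (eLpNorm (f e) 1 (edgeMeasure L μ e)).toReal := by
    rw [eLpNorm_one_eq_lintegral_enorm, integral_norm_eq_lintegral_enorm hint.1]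
  rw [edgeMeasure_rail] at hint hi
  refine ⟨hint, ?_⟩
  rw [hi, hn, ← edgeMeasure_rail L μ b j]
  exact ENNReal.toReal_mono hm.2.ne hle

/-- The trace inequality on a rail. -/
theorem norm_left_le {L μ : ℝ} {u u' : LadderL2 L μ} {f f' : LadderEdge → ℝ → ℂ}
    (h : Represents L μ u f) (h' : Represents L μ u' f') (b : Bool) (j : ℤ)
    (hp : IsPrimitiveOn j (j + 1) (f (rail b j)) (f' (rail b j))) :
    ‖f (rail b j) j‖ ≤ ‖u (rail b j)‖ + ‖u' (rail b j)‖ := by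
  obtain ⟨hi, hl⟩ := setIntegral_norm_le_of_represents h b j
  obtain ⟨hi', hl'⟩ := setIntegral_norm_le_of_represents h' b j
  have key : ∀ x ∈ Ioo (j : ℝ) (j + 1), ‖f (rail b j) j‖ ≤ ‖f (rail b j) x‖ + ‖u' (rail b j)‖ := by
    intro x hx
    have h1 := hp.2 x (Ioo_subset_Icc_self hx)
    have h2 : f (rail b j) j = f (rail b j) x - ∫ t in (j : ℝ)..x, f' (rail b j) t := by
      rw [h1]; ring
    rw [h2]
    refine (norm_sub_le _ _).trans (add_le_add le_rfl ?_)
    refine (intervalIntegral.norm_integral_le_integral_norm hx.1.le).trans (le_trans ?_ hl')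
    rw [intervalIntegral.integral_of_le hx.1.le, integral_Ioc_eq_integral_Ioo]
    exact setIntegral_mono_set hi'.norm (Filter.Eventually.of_forall fun _ => norm_nonneg _)
      (Ioo_subset_Ioo_right hx.2.le).eventuallyLE
  have hvol : volume.real (Ioo (j : ℝ) (j + 1)) = 1 := by simp [Measure.real]
  have h3 : ∫ _ in Ioo (j : ℝ) (j + 1), ‖f (rail b j) j‖
      ≤ ∫ x in Ioo (j : ℝ) (j + 1), (‖f (rail b j) x‖ + ‖u' (rail b j)‖) :=
    -- Averaging the pointwise bound over a rail of length one leaves no constant.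
    setIntegral_mono_on (by simp) (hi.norm.add (by simp)) measurableSet_Ioo key
  rw [integral_add hi.norm (by simp), setIntegral_const, setIntegral_const, hvol] at h3
  simp only [one_smul] at h3
  linarith

theorem LadderL2.tendsto_norm_rail {L μ : ℝ} (u : LadderL2 L μ) (b : Bool) :
    Filter.Tendsto (fun j : ℤ => ‖u (rail b j)‖) Filter.cofinite (nhds 0) := by
  have h1 := (lp.memℓp u).summable (by norm_num)
  have h2 := h1.tendsto_cofinite_zero
  have h3 : Filter.Tendsto (fun e => ‖u e‖) Filter.cofinite (nhds 0) := by
    have := (Real.continuous_sqrt.tendsto 0).comp h2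
    simp only [ENNReal.toReal_ofNat, Real.rpow_ofNat, Real.sqrt_zero] at this
    refine this.congr fun e => ?_
    simp [Real.sqrt_sq]
  exact h3.comp (Function.Injective.tendsto_cofinite fun i j hij => by simpa using hij)

/-- Square integrability over the graph enters the study of eigenfunctions only through this decay,
applied to f and to f'. -/
theorem tendsto_left_zero {L μ : ℝ} {u u' : LadderL2 L μ} {f f' : LadderEdge → ℝ → ℂ}
    (h : Represents L μ u f) (h' : Represents L μ u' f') (b : Bool)
    (hp : ∀ j : ℤ, IsPrimitiveOn j (j + 1) (f (rail b j)) (f' (rail b j))) :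
    Filter.Tendsto (fun j : ℤ => f (rail b j) j) Filter.cofinite (nhds 0) := by
  have h1 := (u.tendsto_norm_rail b).add (u'.tendsto_norm_rail b)
  rw [add_zero] at h1
  exact squeeze_zero_norm (fun j => norm_left_le h h' b j (hp j)) h1

/-! ### Continuous representatives and eigenspaces. -/

theorem ae_edgeMeasure {L μ : ℝ} {e : LadderEdge} {f g : ℝ → ℂ}
    (h : f =ᵐ[volume.restrict (Ioo (lo L e) (hi L e))] g) : f =ᵐ[edgeMeasure L μ e] g :=
  Measure.smul_absolutelyContinuous.ae_eq h

theorem Represents.eq_zero {L μ : ℝ} {u : LadderL2 L μ} {f : LadderEdge → ℝ → ℂ}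
    (hu : Represents L μ u f) (h : ∀ e, ∀ x ∈ Icc (lo L e) (hi L e), f e x = 0) : u = 0 := by
  refine lp.ext (funext fun e => Lp.ext ?_)
  refine (hu e).trans (Filter.EventuallyEq.trans ?_ (Represents.zero e).symm)
  refine ae_edgeMeasure ?_
  rw [Filter.EventuallyEq, ae_restrict_iff' measurableSet_Ioo]
  exact Filter.Eventually.of_forall fun x hx => h e x (Ioo_subset_Icc_self hx)

theorem eqOn_Icc_of_ae_edge {L μ : ℝ} (hL : 0 < L) (hμ : 0 < μ) {e : LadderEdge} {f g : ℝ → ℂ}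
    (h : f =ᵐ[edgeMeasure L μ e] g) (hf : ContinuousOn f (Icc (lo L e) (hi L e)))
    (hg : ContinuousOn g (Icc (lo L e) (hi L e))) : EqOn f g (Icc (lo L e) (hi L e)) := by
  have h' := ae_edge hμ h
  rw [restrict_Ioo_eq_restrict_Icc] at h'
  exact Measure.eqOn_Icc_of_ae_eq volume (lo_lt_hi hL e).ne h' hf hg

theorem ae_comp_neg_rung {L μ : ℝ} (hμ : 0 < μ) {j : ℤ} {f g : ℝ → ℂ}
    (h : f =ᵐ[edgeMeasure L μ (rung j)] g) :
    (fun y => f (-y)) =ᵐ[edgeMeasure L μ (rung j)] fun y => g (-y) := by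
  refine ae_edgeMeasure ?_
  have h' := ae_edge hμ h
  have hp : MeasurePreserving (fun y : ℝ => -y) (volume.restrict (Ioo (-(L / 2)) (L / 2)))
      (volume.restrict (Ioo (-(L / 2)) (L / 2))) := by
    have := (Measure.measurePreserving_neg (volume : Measure ℝ)).restrict_preimage
      (s := Ioo (-(L / 2)) (L / 2)) measurableSet_Ioo
    simpa using this
  exact hp.quasiMeasurePreserving.ae_eq_comp h'

/-- Continuous representatives of symmetric elements are symmetric. -/
theorem symmetric_of_represents {L μ : ℝ} (hL : 0 < L) (hμ : 0 < μ) {u : LadderL2 L μ}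
    (hu : u ∈ ladderSym L μ) {f : LadderEdge → ℝ → ℂ} (hf : Represents L μ u f)
    (hc : ∀ e, ContinuousOn (f e) (Icc (lo L e) (hi L e))) :
    (∀ j, ∀ y ∈ Icc (-(L / 2)) (L / 2), f (rung j) (-y) = f (rung j) y) ∧
      ∀ j : ℤ, ∀ x ∈ Icc (j : ℝ) (j + 1), f (rail true j) x = f (rail false j) x := by
  obtain ⟨s, hs, h1, h2⟩ := hu
  have hfs : ∀ e, f e =ᵐ[edgeMeasure L μ e] s e := fun e => (hf e).symm.trans (hs e)
  constructor
  · intro j y hy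
    have h3 : (fun y => f (rung j) (-y)) =ᵐ[edgeMeasure L μ (rung j)] f (rung j) := by
      refine (ae_comp_neg_rung hμ (hfs (rung j))).trans (Filter.EventuallyEq.trans ?_
        (hfs (rung j)).symm)
      exact Filter.Eventually.of_forall fun y => h1 j y
    refine eqOn_Icc_of_ae_edge hL hμ h3 ?_ (hc _) hy
    refine (hc (rung j)).comp continuous_neg.continuousOn fun t ht => ?_
    simp only [lo, hi, mem_Icc] at ht ⊢
    constructor <;> linarith
  · intro j x hx
    have h3 : f (rail true j) =ᵐ[edgeMeasure L μ (rail true j)] f (rail false j) := by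
      refine (hfs _).trans ?_
      have h4 := (hfs (rail false j)).symm
      rw [edgeMeasure_rail] at h4 ⊢
      refine Filter.EventuallyEq.trans ?_ h4
      exact Filter.Eventually.of_forall fun y => h2 j y
    exact eqOn_Icc_of_ae_edge hL hμ h3 (hc _) (hc (rail false j)) hx

theorem mem_opEigenspace_iff {E : Type*} [NormedAddCommGroup E] [NormedSpace ℂ E]
    (A : E →ₗ.[ℂ] E) (z : ℂ) (u : E) : u ∈ opEigenspace A z ↔ (u, z • u) ∈ A.graph := by
  rw [LinearPMap.mem_graph_iff]
  constructor
  · rintro ⟨h, h'⟩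
    exact ⟨⟨u, h⟩, rfl, h'⟩
  · rintro ⟨⟨y, hy⟩, h1, h2⟩
    dsimp only at h1 h2
    subst h1
    exact ⟨hy, h2⟩

/-- The functions `f`, with edgewise derivatives `f'`, represent an eigenfunction `u` of the
ladder operator. -/
structure IsLadderEigenfunction (L μ : ℝ) (z : ℂ) (u : LadderL2 L μ)
    (f f' : LadderEdge → ℝ → ℂ) : Prop where
  rep : Represents L μ u f
  rep_deriv : ∃ u' : LadderL2 L μ, Represents L μ u' f'
  helmholtz : ∀ e, IsHelmholtzOn z (lo L e) (hi L e) (f e) (f' e)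
  cont : ContinuousAtVertices L f
  kirchhoff : KirchhoffAtVertices L μ f'

/-- The passage from L² classes to classical solutions: −f'' = z f holds almost everywhere, and
`IsPrimitiveOn.congr_ae` makes it hold in integrated form. -/
theorem mem_opEigenspace_ladderSymOp {L μ : ℝ} (hL : 0 < L) (hμ : 0 < μ) (z : ℂ)
    (u : ladderSym L μ) : u ∈ opEigenspace (ladderSymOp L μ) z ↔
      ∃ f f', IsLadderEigenfunction L μ z u f f' := by
  rw [mem_opEigenspace_iff, ladderSymOp_graph hL hμ]
  constructor
  · rintro ⟨f, f', f'', h⟩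
    refine ⟨f, f', h.rep, h.rep_deriv, fun e => ⟨h.prim e, ?_⟩, h.cont, h.kirchhoff⟩
    refine (h.prim' e).congr_ae (lo_lt_hi hL e).le (ae_edge hμ (L := L) (e := e) ?_)
    have h1 := ((h.rep_second e).symm.trans (h.rep.smul z e))
    filter_upwards [h1] with x hx
    linear_combination -hx
  · rintro ⟨f, f', h⟩
    refine ⟨f, f', fun e x => -z * f e x, h.rep, h.rep_deriv, ?_, fun e => (h.helmholtz e).prim,
      fun e => (h.helmholtz e).prim', h.cont, h.kirchhoff⟩
    simpa using h.rep.smul z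

theorem mem_pointSpectrum_iff {E : Type*} [NormedAddCommGroup E] [NormedSpace ℂ E]
    (A : E →ₗ.[ℂ] E) (z : ℂ) : z ∈ pointSpectrum A ↔ ∃ u ∈ opEigenspace A z, u ≠ 0 :=
  (opEigenspace A z).ne_bot_iff

theorem pointSpectrum_subset_opSpectrum {E : Type*} [NormedAddCommGroup E] [NormedSpace ℂ E]
    (A : E →ₗ.[ℂ] E) : pointSpectrum A ⊆ opSpectrum A := by
  rintro z hz ⟨R, -, hR⟩
  obtain ⟨u, ⟨hu, hu'⟩, hne⟩ := (mem_pointSpectrum_iff A z).1 hz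
  have := hR ⟨u, hu⟩
  rw [hu', sub_self, map_zero] at this
  exact hne this.symm

/-- Even solutions of `f'' = -ω² f` on a rung. -/
theorem IsHelmholtzOn.even {L ω : ℝ} (hL : 0 < L) (hω : ω ≠ 0) {f f' : ℝ → ℂ}
    (h : IsHelmholtzOn ((ω ^ 2 : ℝ) : ℂ) (-(L / 2)) (L / 2) f f')
    (he : ∀ y ∈ Icc (-(L / 2)) (L / 2), f (-y) = f y) :
    (∀ y ∈ Icc (-(L / 2)) (L / 2), f y = f 0 * Real.cos (ω * y)) ∧
      f' (L / 2) = -ω * Real.sin (ω * L / 2) * f 0 ∧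
      f' (-(L / 2)) = ω * Real.sin (ω * L / 2) * f 0 := by
  have hab : -(L / 2) ≤ L / 2 := by linarith
  have h0I : (0 : ℝ) ∈ Ioo (-(L / 2)) (L / 2) := ⟨by linarith, by linarith⟩
  have hd0 : f' 0 = 0 := by
    have h1 := h.hasDerivAt h0I
    have h2 : HasDerivAt f (-f' 0) 0 := by
      have h3 : HasDerivAt f (f' 0) (-0) := by simpa using h1
      have h4 := h3.scomp (0 : ℝ) (hasDerivAt_neg (0 : ℝ))
      simp only [neg_smul, one_smul] at h4
      refine h4.congr_of_eventuallyEq ?_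
      filter_upwards [Ioo_mem_nhds h0I.1 h0I.2] with y hy
      exact (he y (Ioo_subset_Icc_self hy)).symm
    have h5 := h1.unique h2
    exact self_eq_neg.1 h5
  have hω' : (ω : ℂ) ≠ 0 := by exact_mod_cast hω
  -- The solution formula is anchored at −L/2; evaluated at 0, where f' vanishes by evenness, it is
  -- a rotation that can be inverted to express the data at −L/2 through f 0.
  obtain ⟨h1, h2⟩ := h.eq_cos_sin hω hab (Ioo_subset_Icc_self h0I)
  have ha : ω * (0 - -(L / 2)) = ω * L / 2 := by ring
  rw [ha] at h1 h2
  rw [hd0] at h2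
  set C : ℂ := ((Real.cos (ω * L / 2) : ℝ) : ℂ) with hC
  set S : ℂ := ((Real.sin (ω * L / 2) : ℝ) : ℂ) with hS
  have hcs : C ^ 2 + S ^ 2 = 1 := by
    rw [hC, hS]
    exact_mod_cast Real.cos_sq_add_sin_sq (ω * L / 2)
  have hfa : f (-(L / 2)) = C * f 0 := by
    field_simp at h1
    apply mul_left_cancel₀ hω'
    linear_combination -C * h1 + S * h2 - ω * f (-(L / 2)) * hcs
  have hfa' : f' (-(L / 2)) = ω * S * f 0 := by
    field_simp at h1
    linear_combination -S * h1 - C * h2 - f' (-(L / 2)) * hcs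
  have hgen : ∀ y ∈ Icc (-(L / 2)) (L / 2), f y = f 0 * Real.cos (ω * y) ∧
      f' y = -ω * f 0 * Real.sin (ω * y) := by
    intro y hy
    obtain ⟨k1, k2⟩ := h.eq_cos_sin hω hab hy
    have hb : ω * (y - -(L / 2)) = ω * y + ω * L / 2 := by ring
    rw [hb, Real.cos_add, Real.sin_add, hfa, hfa'] at k1 k2
    push_cast [← hC, ← hS] at k1 k2
    constructor
    · rw [k1]
      push_cast
      field_simp
      linear_combination (f 0 * Complex.cos (ω * y)) * hcs
    · rw [k2]
      push_cast
      linear_combination (-ω * f 0 * Complex.sin (ω * y)) * hcs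
  refine ⟨fun y hy => (hgen y hy).1, ?_, hfa'⟩
  have := (hgen (L / 2) ⟨hab, le_rfl⟩).2
  have hb : ω * (L / 2) = ω * L / 2 := by ring
  rw [this, hb]
  ring

/-! ### Decaying solutions of three-term recursions. -/

theorem eq_zero_of_tendsto_of_norm_le_succ {a : ℕ → ℂ}
    (ha : Filter.Tendsto a Filter.atTop (nhds 0)) (h : ∀ n, ‖a n‖ ≤ ‖a (n + 1)‖) (n : ℕ) :
    a n = 0 := by
  have hm : Monotone fun n => ‖a n‖ := monotone_nat_of_le_succ h
  have h1 := hm.ge_of_tendsto (by simpa using ha.norm) n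
  simpa using h1

/-- The roots g ± s have product one, so one of them lies in the closed unit disc. -/
theorem exists_root_norm_le_one (g : ℝ) : ∃ κ : ℂ, ‖κ‖ ≤ 1 ∧ κ ^ 2 - 2 * g * κ + 1 = 0 := by
  obtain ⟨s, hs⟩ := IsAlgClosed.exists_pow_nat_eq ((g : ℂ) ^ 2 - 1) (n := 2) (by norm_num)
  by_cases h : ‖g + s‖ ≤ 1
  · exact ⟨g + s, h, by linear_combination hs⟩
  · refine ⟨g - s, ?_, by linear_combination hs⟩
    have h1 : ‖(g + s : ℂ)‖ * ‖(g - s : ℂ)‖ = 1 := by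
      rw [← norm_mul, show ((g : ℂ) + s) * (g - s) = 1 by linear_combination -hs, norm_one]
    push Not at h
    nlinarith [norm_nonneg (g - s : ℂ)]

/-- The imaginary part of the equation gives a non-real root the real part g; the real part of the
equation then puts it on the unit circle. -/
theorem real_of_root_of_norm_lt_one {g : ℝ} {κ : ℂ} (hκ : ‖κ‖ < 1)
    (h : κ ^ 2 - 2 * g * κ + 1 = 0) : ∃ k : ℝ, κ = k := by
  refine ⟨κ.re, Complex.ext rfl ?_⟩
  have hn : κ.re ^ 2 + κ.im ^ 2 < 1 := by
    have := Complex.sq_norm κ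
    rw [Complex.normSq_apply] at this
    nlinarith [norm_nonneg κ]
  have h1 := congrArg Complex.re h
  have h2 := congrArg Complex.im h
  simp [pow_two] at h1 h2
  simp only [Complex.ofReal_im]
  by_contra him
  have h3 : κ.re = g := by
    apply mul_right_cancel₀ him
    linarith
  rw [← h3] at h1
  nlinarith

/-- Solutions of a three-term recursion that tend to zero. -/
theorem recursion_decay {g : ℝ} {a : ℕ → ℂ} (ha : Filter.Tendsto a Filter.atTop (nhds 0))
    (h : ∀ n, a (n + 2) + a n = 2 * g * a (n + 1)) :
    (∀ n, a n = 0) ∨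
      ∃ κ : ℝ, |κ| < 1 ∧ κ ^ 2 - 2 * g * κ + 1 = 0 ∧ ∀ n, a (n + 1) = κ * a n := by
  obtain ⟨κ, hκ1, hκ⟩ := exists_root_norm_le_one g
  -- The defect d_n = a_{n+1} − κ a_n satisfies d_n = κ d_{n+1}, so its norm is nondecreasing while
  -- it tends to zero. This covers the double root as well.
  have hd : ∀ n, a (n + 1) - κ * a n = 0 := by
    refine eq_zero_of_tendsto_of_norm_le_succ (a := fun n => a (n + 1) - κ * a n) ?_ ?_
    · simpa using ((Filter.tendsto_add_atTop_iff_nat 1).2 ha).sub (ha.const_mul κ)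
    · intro n
      have h1 : a (n + 1) - κ * a n = κ * (a (n + 2) - κ * a (n + 1)) := by
        linear_combination -κ * h n + a (n + 1) * hκ
      rw [h1, norm_mul]
      exact mul_le_of_le_one_left (norm_nonneg _) hκ1
  have hd' : ∀ n, a (n + 1) = κ * a n := fun n => sub_eq_zero.1 (hd n)
  rcases hκ1.lt_or_eq with hlt | heq
  · right
    obtain ⟨k, rfl⟩ := real_of_root_of_norm_lt_one hlt hκ
    refine ⟨k, by simpa using hlt, by exact_mod_cast hκ, hd'⟩
  · left
    refine eq_zero_of_tendsto_of_norm_le_succ ha fun n => ?_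
    rw [hd' n, norm_mul, heq, one_mul]

/-- Two distinct roots have product one. Hence both halves of the ladder decay with the same ratio.
-/
theorem decaying_root_unique {g κ κ' : ℝ} (h1 : |κ| < 1) (h1' : |κ'| < 1)
    (h : κ ^ 2 - 2 * g * κ + 1 = 0) (h' : κ' ^ 2 - 2 * g * κ' + 1 = 0) : κ = κ' := by
  have hf : (κ - κ') * (κ * κ' - 1) = 0 := by linear_combination κ' * h - κ * h'
  rcases mul_eq_zero.1 hf with h2 | h2
  · exact sub_eq_zero.1 h2
  · have h3 : |κ| * |κ'| = 1 := by rw [← abs_mul, sub_eq_zero.1 h2, abs_one]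
    nlinarith [abs_nonneg κ, abs_nonneg κ']

/-- The equation is (κ − g)² = g² − 1: for |g| ≤ 1 it forces κ = g and g² = 1, against |κ| < 1. So
nothing decays inside a band. -/
theorem one_lt_abs_of_decaying_root {g κ : ℝ} (h1 : |κ| < 1) (h : κ ^ 2 - 2 * g * κ + 1 = 0) :
    1 < |g| := by
  by_contra hg
  push Not at hg
  have h2 : g ^ 2 ≤ 1 := by
    rw [← sq_abs]
    nlinarith [abs_nonneg g]
  have h3 : κ ^ 2 < 1 := by
    rw [← sq_abs]
    nlinarith [abs_nonneg κ]
  have h4 : κ = g := by nlinarith [sq_nonneg (κ - g)]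
  subst h4
  nlinarith

/-! ### The recursion for the vertex values. -/

/-- The coefficient of the recursion for the vertex values at a rung of weight `w`. -/
def vertexCoeff (L w ω : ℝ) : ℝ :=
  Real.cos ω - w / 2 * (Real.sin ω * Real.tan (ω * L / 2))

/-- Symmetric decaying solutions of `f'' = -ω² f` on the ladder, except possibly on the
rung `0`. -/
structure IsOffCentreSolution (L μ ω : ℝ) (f f' : LadderEdge → ℝ → ℂ) : Prop where
  helmholtz_rail : ∀ b (j : ℤ),
    IsHelmholtzOn ((ω ^ 2 : ℝ) : ℂ) j (j + 1) (f (rail b j)) (f' (rail b j))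
  helmholtz_rung : ∀ j, j ≠ 0 →
    IsHelmholtzOn ((ω ^ 2 : ℝ) : ℂ) (-(L / 2)) (L / 2) (f (rung j)) (f' (rung j))
  even : ∀ j, ∀ y ∈ Icc (-(L / 2)) (L / 2), f (rung j) (-y) = f (rung j) y
  cont : ContinuousAtVertices L f
  kirchhoff : KirchhoffAtVertices L μ f'
  tendsto : Filter.Tendsto (fun j : ℤ => f (rail true j) j) Filter.cofinite (nhds 0)

namespace IsOffCentreSolution

variable {L μ ω : ℝ} {f f' : LadderEdge → ℝ → ℂ}

theorem rung_eq (h : IsOffCentreSolution L μ ω f f') (j : ℤ) :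
    f (rung j) (L / 2) = f (rail true j) j := (h.cont j).1.1

/-- Evenness on the rung carries the value at (j, L/2) to (j, −L/2), so one sequence of vertex
values serves both rails. -/
theorem rail_left (h : IsOffCentreSolution L μ ω f f') (hL : 0 < L) (b : Bool) (j : ℤ) :
    f (rail b j) j = f (rail true j) j := by
  cases b
  · rw [← (h.cont j).2.1, h.even j (L / 2) ⟨by linarith, le_rfl⟩, h.rung_eq]
  · rfl

theorem rail_right (h : IsOffCentreSolution L μ ω f f') (hL : 0 < L) (b : Bool) (j : ℤ) :
    f (rail b j) (j + 1) = f (rail true (j + 1)) ((j + 1 : ℤ) : ℝ) := by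
  have h1 := h.cont (j + 1)
  rw [add_sub_cancel_right] at h1
  have h2 : ((j + 1 : ℤ) : ℝ) = (j : ℝ) + 1 := by push_cast; ring
  rw [h2] at h1 ⊢
  cases b
  · rw [← h1.2.2, h.even (j + 1) (L / 2) ⟨by linarith, le_rfl⟩, h1.1.1]
  · rw [← h1.1.2, h1.1.1]

theorem rail_solution (h : IsOffCentreSolution L μ ω f f') (hω : ω ≠ 0) (b : Bool) (j : ℤ) :
    f (rail b j) (j + 1) = f (rail b j) j * Real.cos ω + f' (rail b j) j / ω * Real.sin ω ∧
      f' (rail b j) (j + 1)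
        = -ω * f (rail b j) j * Real.sin ω + f' (rail b j) j * Real.cos ω := by
  have := (h.helmholtz_rail b j).eq_cos_sin hω (by linarith) (x := j + 1) ⟨by linarith, le_rfl⟩
  simpa using this

/-- The Dirichlet-to-Neumann relation of a rail, multiplied by sin ω so that it needs no division.
-/
theorem sin_mul_deriv_left (h : IsOffCentreSolution L μ ω f f') (hL : 0 < L) (hω : ω ≠ 0)
    (b : Bool) (j : ℤ) : Real.sin ω * f' (rail b j) j
      = ω * (f (rail true (j + 1)) ((j + 1 : ℤ) : ℝ) - Real.cos ω * f (rail true j) j) := by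
  have hω' : (ω : ℂ) ≠ 0 := by exact_mod_cast hω
  have h1 := (h.rail_solution hω b j).1
  rw [h.rail_right hL, h.rail_left hL b j] at h1
  rw [h1]
  field_simp
  ring

theorem sin_mul_deriv_right (h : IsOffCentreSolution L μ ω f f') (hL : 0 < L) (hω : ω ≠ 0)
    (b : Bool) (j : ℤ) : Real.sin ω * f' (rail b j) (j + 1)
      = ω * (Real.cos ω * f (rail true (j + 1)) ((j + 1 : ℤ) : ℝ) - f (rail true j) j) := by
  have h1 := h.sin_mul_deriv_left hL hω b j
  rw [(h.rail_solution hω b j).2, h.rail_left hL b j]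
  have hcs : ((Real.cos ω : ℝ) : ℂ) ^ 2 + ((Real.sin ω : ℝ) : ℂ) ^ 2 = 1 := by
    exact_mod_cast Real.cos_sq_add_sin_sq ω
  linear_combination (Real.cos ω : ℂ) * h1 - (ω * f (rail true j) j) * hcs

/-- Kirchhoff's condition at (j, L/2) times sin ω, with the rail derivatives eliminated by the
Dirichlet-to-Neumann relations and the rung derivative equal to −ω tan(ωL/2) times the vertex value.
The equation on rung j is a separate assumption because it may fail for j = 0. -/
theorem recursion (h : IsOffCentreSolution L μ ω f f') (hL : 0 < L) (hω : ω ≠ 0)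
    (hC : Real.cos (ω * L / 2) ≠ 0) (j : ℤ)
    (hj : IsHelmholtzOn ((ω ^ 2 : ℝ) : ℂ) (-(L / 2)) (L / 2) (f (rung j)) (f' (rung j))) :
    f (rail true (j + 1)) ((j + 1 : ℤ) : ℝ) + f (rail true (j - 1)) ((j - 1 : ℤ) : ℝ)
      = 2 * (vertexCoeff L (weight μ (rung j)) ω : ℝ) * f (rail true j) j := by
  have hω' : (ω : ℂ) ≠ 0 := by exact_mod_cast hω
  have hC' : ((Real.cos (ω * L / 2) : ℝ) : ℂ) ≠ 0 := by exact_mod_cast hC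
  obtain ⟨h1, h2, -⟩ := hj.even hL hω (h.even j)
  have h3 := h1 (L / 2) ⟨by linarith, le_rfl⟩
  rw [h.rung_eq, show ω * (L / 2) = ω * L / 2 by ring] at h3
  have h4 := (h.kirchhoff j).1
  have h5 := h.sin_mul_deriv_left hL hω true j
  have h6 := h.sin_mul_deriv_right hL hω true (j - 1)
  have h7 : ((j - 1 : ℤ) : ℝ) + 1 = j := by push_cast; ring
  rw [h7, sub_add_cancel] at h6
  rw [h2] at h4
  set w : ℝ := weight μ (rung j)
  have hv : ((Real.cos (ω * L / 2) : ℝ) : ℂ) * (vertexCoeff L w ω : ℝ)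
      = Real.cos (ω * L / 2) * Real.cos ω - w / 2 * (Real.sin ω * Real.sin (ω * L / 2)) := by
    have : Real.cos (ω * L / 2) * vertexCoeff L w ω
        = Real.cos (ω * L / 2) * Real.cos ω - w / 2 * (Real.sin ω * Real.sin (ω * L / 2)) := by
      rw [vertexCoeff, Real.tan_eq_sin_div_cos]
      field_simp
    rw [← Complex.ofReal_mul, this]
    push_cast
    ring
  simp only [weight, Complex.ofReal_one, one_mul] at h4
  apply mul_left_cancel₀ hω'
  apply mul_left_cancel₀ hC'
  linear_combination (Real.cos (ω * L / 2) * Real.sin ω : ℂ) * h4 -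
    (Real.cos (ω * L / 2) : ℂ) * h5 + (Real.cos (ω * L / 2) : ℂ) * h6 +
    (w * ω * Real.sin ω * Real.sin (ω * L / 2) : ℂ) * h3
    - 2 * ω * f (rail true j) j * hv

theorem tendsto_ray (h : IsOffCentreSolution L μ ω f f') (s : ℤ) (hs : s ≠ 0) :
    Filter.Tendsto (fun n : ℕ => f (rail true (s * n)) ((s * n : ℤ) : ℝ)) Filter.atTop
      (nhds 0) := by
  rw [← Nat.cofinite_eq_atTop]
  refine h.tendsto.comp (Function.Injective.tendsto_cofinite fun m n hmn => ?_)
  have : (m : ℤ) = n := mul_left_cancel₀ hs hmn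
  exact_mod_cast this

/-- The sign s selects the right or the left half of the ladder. The recursion is centred at s(n +
1) ≠ 0, where the weight is one and no source is present. -/
theorem ray (h : IsOffCentreSolution L μ ω f f') (hL : 0 < L) (hω : ω ≠ 0)
    (hC : Real.cos (ω * L / 2) ≠ 0) (s : ℤ) (hs : s = 1 ∨ s = -1) :
    (∀ n : ℕ, f (rail true (s * n)) ((s * n : ℤ) : ℝ) = 0) ∨
      ∃ κ : ℝ, |κ| < 1 ∧ κ ^ 2 - 2 * vertexCoeff L 1 ω * κ + 1 = 0 ∧
        ∀ n : ℕ, f (rail true (s * (n + 1 : ℕ))) ((s * (n + 1 : ℕ) : ℤ) : ℝ)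
          = κ * f (rail true (s * n)) ((s * n : ℤ) : ℝ) := by
  have hs0 : s ≠ 0 := by rcases hs with rfl | rfl <;> norm_num
  refine recursion_decay (h.tendsto_ray s hs0) fun n => ?_
  have hj : s * ((n + 1 : ℕ) : ℤ) ≠ 0 := mul_ne_zero hs0 (by positivity)
  have h1 := h.recursion hL hω hC _ (h.helmholtz_rung _ hj)
  simp only [weight, if_neg hj] at h1
  rcases hs with rfl | rfl
  · rw [← h1]
    congr 2 <;> push_cast <;> ring_nf
  · rw [← h1, add_comm]
    congr 2 <;> push_cast <;> ring_nf

/-- The vertex values of an off-centre solution either vanish or decay geometrically. -/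
theorem vertex_values (h : IsOffCentreSolution L μ ω f f') (hL : 0 < L) (hω : ω ≠ 0)
    (hC : Real.cos (ω * L / 2) ≠ 0) :
    (∀ j : ℤ, f (rail true j) j = 0) ∨
      (f (rail true 0) ((0 : ℤ) : ℝ) ≠ 0 ∧
      ∃ κ : ℝ, |κ| < 1 ∧ κ ^ 2 - 2 * vertexCoeff L 1 ω * κ + 1 = 0 ∧
        f (rail true 1) ((1 : ℤ) : ℝ) = κ * f (rail true 0) ((0 : ℤ) : ℝ) ∧
        f (rail true (-1)) ((-1 : ℤ) : ℝ) = κ * f (rail true 0) ((0 : ℤ) : ℝ)) := by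
  by_cases h0 : f (rail true 0) ((0 : ℤ) : ℝ) = 0
  · left
    have hray : ∀ s : ℤ, s = 1 ∨ s = -1 →
        ∀ n : ℕ, f (rail true (s * n)) ((s * n : ℤ) : ℝ) = 0 := by
      intro s hs
      rcases h.ray hL hω hC s hs with h1 | ⟨κ, -, -, h1⟩
      · exact h1
      · intro n
        induction n with
        | zero => simpa using h0
        | succ n ih => rw [h1, ih, mul_zero]
    intro j
    obtain ⟨n, rfl | rfl⟩ := j.eq_nat_or_neg
    · simpa using hray 1 (Or.inl rfl) n
    · simpa using hray (-1) (Or.inr rfl) n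
  · right
    refine ⟨h0, ?_⟩
    rcases h.ray hL hω hC 1 (Or.inl rfl) with h1 | ⟨κ, hκ, hκ', h1⟩
    · exact absurd (by simpa using h1 0) h0
    rcases h.ray hL hω hC (-1) (Or.inr rfl) with h2 | ⟨κ₂, hκ₂, hκ₂', h2⟩
    · exact absurd (by simpa using h2 0) h0
    obtain rfl := decaying_root_unique hκ hκ₂ hκ' hκ₂'
    exact ⟨κ, hκ, hκ', by simpa using h1 0, by simpa using h2 0⟩

theorem deriv_rail_eq_zero (h : IsOffCentreSolution L μ ω f f') (hL : 0 < L) (hω : ω ≠ 0)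
    (hs : Real.sin ω ≠ 0) (h0 : ∀ j : ℤ, f (rail true j) j = 0) (b : Bool) (j : ℤ) :
    f' (rail b j) j = 0 ∧ f' (rail b j) (j + 1) = 0 := by
  have hs' : ((Real.sin ω : ℝ) : ℂ) ≠ 0 := by exact_mod_cast hs
  have h1 := h.sin_mul_deriv_left hL hω b j
  have h2 := h.sin_mul_deriv_right hL hω b j
  rw [h0, h0] at h1 h2
  simp only [mul_zero, sub_self] at h1 h2
  exact ⟨(mul_eq_zero.1 h1).resolve_left hs', (mul_eq_zero.1 h2).resolve_left hs'⟩

theorem rail_eq_zero (h : IsOffCentreSolution L μ ω f f') (hω : ω ≠ 0) (b : Bool) (j : ℤ)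
    (h0 : f (rail b j) j = 0) (h0' : f' (rail b j) j = 0) :
    ∀ x ∈ Icc (j : ℝ) (j + 1), f (rail b j) x = 0 := by
  intro x hx
  rw [((h.helmholtz_rail b j).eq_cos_sin hω (by linarith) hx).1, h0, h0']
  simp

theorem deriv_rung_eq_zero (h : IsOffCentreSolution L μ ω f f') (hμ : 0 < μ) (j : ℤ)
    (h0 : ∀ b (j : ℤ), f' (rail b j) j = 0 ∧ f' (rail b j) (j + 1) = 0) :
    f' (rung j) (L / 2) = 0 ∧ f' (rung j) (-(L / 2)) = 0 := by
  obtain ⟨h1, h2⟩ := h.kirchhoff j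
  have h7 : ((j - 1 : ℤ) : ℝ) + 1 = j := by push_cast; ring
  have h8 : ∀ b, f' (rail b (j - 1)) j = 0 := fun b => by
    rw [← h7]
    exact (h0 b (j - 1)).2
  rw [(h0 _ j).1, h8] at h1 h2
  have hw : (weight μ (rung j) : ℂ) ≠ 0 := by
    simp only [weight]
    split_ifs
    · exact_mod_cast hμ.ne'
    · simp
  simp only [mul_zero, neg_zero, add_zero, mul_eq_zero, hw, false_or, neg_eq_zero] at h1 h2
  exact ⟨h1, h2⟩

end IsOffCentreSolution

theorem IsHelmholtzOn.eq_zero_of_even {L ω : ℝ} (hL : 0 < L) (hω : ω ≠ 0) {f f' : ℝ → ℂ}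
    (h : IsHelmholtzOn ((ω ^ 2 : ℝ) : ℂ) (-(L / 2)) (L / 2) f f')
    (he : ∀ y ∈ Icc (-(L / 2)) (L / 2), f (-y) = f y)
    (h0 : f (L / 2) = 0) (h0' : f' (L / 2) = 0) : ∀ y ∈ Icc (-(L / 2)) (L / 2), f y = 0 := by
  obtain ⟨h1, h2, -⟩ := h.even hL hω he
  have h3 := h1 (L / 2) ⟨by linarith, le_rfl⟩
  rw [h0, show ω * (L / 2) = ω * L / 2 by ring] at h3
  rw [h0'] at h2
  have hω' : (ω : ℂ) ≠ 0 := by exact_mod_cast hω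
  have hcs : ((Real.cos (ω * L / 2) : ℝ) : ℂ) ^ 2 + ((Real.sin (ω * L / 2) : ℝ) : ℂ) ^ 2 = 1 := by
    exact_mod_cast Real.cos_sq_add_sin_sq (ω * L / 2)
  have h4 : f 0 = 0 := by
    apply mul_left_cancel₀ hω'
    linear_combination (-ω * Real.cos (ω * L / 2)) * h3 + (Real.sin (ω * L / 2) : ℂ) * h2
      - ω * f 0 * hcs
  intro y hy
  rw [h1 y hy, h4, zero_mul]

/-! ### Necessary conditions for eigenfunctions. -/

namespace IsLadderEigenfunction

variable {L μ : ℝ} {z : ℂ} {u : LadderL2 L μ} {f f' : LadderEdge → ℝ → ℂ}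

theorem tendsto_rail (h : IsLadderEigenfunction L μ z u f f') (b : Bool) :
    Filter.Tendsto (fun j : ℤ => f (rail b j) j) Filter.cofinite (nhds 0) := by
  obtain ⟨u', hu'⟩ := h.rep_deriv
  exact tendsto_left_zero h.rep hu' b fun j => (h.helmholtz (rail b j)).prim

theorem tendsto_deriv_rail (h : IsLadderEigenfunction L μ z u f f') (b : Bool) :
    Filter.Tendsto (fun j : ℤ => f' (rail b j) j) Filter.cofinite (nhds 0) := by
  obtain ⟨u', hu'⟩ := h.rep_deriv
  exact tendsto_left_zero hu' (h.rep.smul (-z)) b fun j => (h.helmholtz (rail b j)).prim'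

theorem symmetric (h : IsLadderEigenfunction L μ z u f f') (hL : 0 < L) (hμ : 0 < μ)
    (hu : u ∈ ladderSym L μ) :
    (∀ j, ∀ y ∈ Icc (-(L / 2)) (L / 2), f (rung j) (-y) = f (rung j) y) ∧
      ∀ j : ℤ, ∀ x ∈ Icc (j : ℝ) (j + 1), f (rail true j) x = f (rail false j) x :=
  symmetric_of_represents hL hμ hu h.rep
    fun e => (h.helmholtz e).continuousOn (lo_lt_hi hL e).le

variable {ω : ℝ}

theorem offCentre (h : IsLadderEigenfunction L μ ((ω ^ 2 : ℝ) : ℂ) u f f') (hL : 0 < L)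
    (hμ : 0 < μ) (hu : u ∈ ladderSym L μ) : IsOffCentreSolution L μ ω f f' where
  helmholtz_rail b j := h.helmholtz (rail b j)
  helmholtz_rung j _ := h.helmholtz (rung j)
  even := (h.symmetric hL hμ hu).1
  cont := h.cont
  kirchhoff := h.kirchhoff
  tendsto := h.tendsto_rail true

theorem eq_zero_of_edges (h : IsLadderEigenfunction L μ z u f f')
    (hrail : ∀ b (j : ℤ), ∀ x ∈ Icc (j : ℝ) (j + 1), f (rail b j) x = 0)
    (hrung : ∀ j : ℤ, ∀ y ∈ Icc (-(L / 2)) (L / 2), f (rung j) y = 0) : u = 0 :=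
  h.rep.eq_zero fun e => by
    cases e with
    | rung j => exact hrung j
    | rail b j => exact hrail b j

theorem eq_zero_of_vertices (h : IsLadderEigenfunction L μ ((ω ^ 2 : ℝ) : ℂ) u f f') (hL : 0 < L)
    (hμ : 0 < μ) (hu : u ∈ ladderSym L μ) (hω : ω ≠ 0) (hs : Real.sin ω ≠ 0)
    (h0 : ∀ j : ℤ, f (rail true j) j = 0) : u = 0 := by
  have ho := h.offCentre hL hμ hu
  have hd := ho.deriv_rail_eq_zero hL hω hs h0
  refine h.eq_zero_of_edges (fun b j => ?_) fun j => ?_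
  · exact ho.rail_eq_zero hω b j (by rw [ho.rail_left hL, h0]) (hd b j).1
  · exact (h.helmholtz (rung j)).eq_zero_of_even hL hω (ho.even j)
      ((ho.rung_eq j).trans (h0 j)) (ho.deriv_rung_eq_zero hμ j hd).1

theorem mul_vertex (h : IsLadderEigenfunction L μ ((ω ^ 2 : ℝ) : ℂ) u f f') (hL : 0 < L)
    (hμ : 0 < μ) (hu : u ∈ ladderSym L μ) (hω : ω ≠ 0) (j : ℤ) :
    f (rail true j) j = f (rung j) 0 * Real.cos (ω * L / 2) := by
  have ho := h.offCentre hL hμ hu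
  have h1 := ((h.helmholtz (rung j)).even hL hω (ho.even j)).1 (L / 2) ⟨by linarith, le_rfl⟩
  rw [← ho.rung_eq, h1, show ω * (L / 2) = ω * L / 2 by ring]

/-- No eigenfunction is supported by the rungs alone. -/
theorem eq_zero_of_cos_eq_zero (h : IsLadderEigenfunction L μ ((ω ^ 2 : ℝ) : ℂ) u f f')
    (hL : 0 < L) (hμ : 0 < μ) (hu : u ∈ ladderSym L μ) (hω : ω ≠ 0) (hs : Real.sin ω ≠ 0)
    (hC : Real.cos (ω * L / 2) = 0) : u = 0 :=
  h.eq_zero_of_vertices hL hμ hu hω hs fun j => by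
    rw [h.mul_vertex hL hμ hu hω, hC]
    simp

/-- When sin ω = 0 a rail transmits f and f' up to sign. The vertex values then have constant
modulus and vanish by decay; since cos(ωL/2) ≠ 0 the rungs vanish too, Kirchhoff's condition no
longer sees them, and the same argument applies to f'. -/
theorem eq_zero_of_sin_eq_zero (h : IsLadderEigenfunction L μ ((ω ^ 2 : ℝ) : ℂ) u f f')
    (hL : 0 < L) (hμ : 0 < μ) (hu : u ∈ ladderSym L μ) (hω : ω ≠ 0) (hs : Real.sin ω = 0)
    (hC : Real.cos (ω * L / 2) ≠ 0) : u = 0 := by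
  have ho := h.offCentre hL hμ hu
  have hC' : ((Real.cos (ω * L / 2) : ℝ) : ℂ) ≠ 0 := by exact_mod_cast hC
  have hcos : ‖((Real.cos ω : ℝ) : ℂ)‖ = 1 := by
    have := Real.cos_sq_add_sin_sq ω
    rw [hs] at this
    rw [Complex.norm_real, Real.norm_eq_abs]
    nlinarith [abs_nonneg (Real.cos ω), sq_abs (Real.cos ω)]
  have hconst : ∀ p : ℤ → ℂ, Filter.Tendsto p Filter.cofinite (nhds 0) →
      (∀ j, ‖p (j + 1)‖ = ‖p j‖) → ∀ j, p j = 0 := by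
    intro p hp hj j
    have h1 := eq_zero_of_tendsto_of_norm_le_succ (a := fun n : ℕ => p (j + n)) (by
      rw [← Nat.cofinite_eq_atTop]
      exact hp.comp (Function.Injective.tendsto_cofinite fun m n hmn => by simpa using hmn))
      (fun n => by
        rw [← hj (j + n)]
        exact le_of_eq (by push_cast; ring_nf)) 0
    simpa using h1
  have ha : ∀ j : ℤ, f (rail true j) j = 0 := by
    refine hconst _ ho.tendsto fun j => ?_
    rw [← ho.rail_right hL true j, (ho.rail_solution hω true j).1, hs, Complex.ofReal_zero,
      mul_zero, add_zero, norm_mul, hcos, mul_one]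
  have hr : ∀ j : ℤ, f (rung j) 0 = 0 := fun j => by
    have := h.mul_vertex hL hμ hu hω j
    rw [ha, eq_comm, mul_eq_zero] at this
    exact this.resolve_right hC'
  have hd : ∀ j : ℤ, f' (rail true j) j = 0 := by
    refine hconst _ (h.tendsto_deriv_rail true) fun j => ?_
    have h1 := (h.kirchhoff (j + 1)).1
    have h2 := ((h.helmholtz (rung (j + 1))).even hL hω (ho.even _)).2.1
    rw [hr, mul_zero] at h2
    rw [h2, add_sub_cancel_right] at h1
    simp only [weight, Complex.ofReal_one, one_mul, neg_zero, mul_zero, zero_add] at h1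
    rw [eq_neg_of_add_eq_zero_left h1, neg_neg]
    push_cast
    rw [(ho.rail_solution hω true j).2, hs, Complex.ofReal_zero,
      mul_zero, zero_add, norm_mul, hcos, mul_one]
  have htrue : ∀ j : ℤ, ∀ x ∈ Icc (j : ℝ) (j + 1), f (rail true j) x = 0 :=
    fun j => ho.rail_eq_zero hω true j (ha j) (hd j)
  refine h.eq_zero_of_edges (fun b j x hx => ?_) fun j y hy => ?_
  · cases b
    · rw [← (h.symmetric hL hμ hu).2 j x hx, htrue j x hx]
    · exact htrue j x hx
  · rw [((h.helmholtz (rung j)).even hL hω (ho.even j)).1 y hy, hr, zero_mul]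

/-- An eigenfunction is determined by its value at the central vertex, which is the source of
simplicity. -/
theorem eq_zero_of_centre (h : IsLadderEigenfunction L μ ((ω ^ 2 : ℝ) : ℂ) u f f') (hL : 0 < L)
    (hμ : 0 < μ) (hu : u ∈ ladderSym L μ) (hω : ω ≠ 0) (hs : Real.sin ω ≠ 0)
    (hC : Real.cos (ω * L / 2) ≠ 0) (h0 : f (rail true 0) ((0 : ℤ) : ℝ) = 0) : u = 0 := by
  rcases (h.offCentre hL hμ hu).vertex_values hL hω hC with h1 | h1
  · exact h.eq_zero_of_vertices hL hμ hu hω hs h1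
  · exact absurd h0 h1.1

/-- Both halves decay with the same ratio κ, so the recursion at the centre is 2κ a₀ = 2 g_μ a₀ and
identifies κ with `vertexCoeff L μ ω`; the rest is what is known about κ. -/
theorem dispersion (h : IsLadderEigenfunction L μ ((ω ^ 2 : ℝ) : ℂ) u f f') (hL : 0 < L)
    (hμ : 0 < μ) (hu : u ∈ ladderSym L μ) (hω : ω ≠ 0) (hs : Real.sin ω ≠ 0)
    (hC : Real.cos (ω * L / 2) ≠ 0) (hne : u ≠ 0) :
    |vertexCoeff L μ ω| < 1 ∧
      vertexCoeff L μ ω ^ 2 - 2 * vertexCoeff L 1 ω * vertexCoeff L μ ω + 1 = 0 := by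
  have ho := h.offCentre hL hμ hu
  rcases ho.vertex_values hL hω hC with h1 | ⟨h0, κ, hκ, hκ', h1, h2⟩
  · exact absurd (h.eq_zero_of_vertices hL hμ hu hω hs h1) hne
  · have h3 := ho.recursion hL hω hC 0 (h.helmholtz (rung 0))
    simp only [zero_add, zero_sub, weight, if_true] at h3
    rw [h1, h2] at h3
    have h4 : (κ : ℂ) = (vertexCoeff L μ ω : ℝ) := by
      apply mul_right_cancel₀ h0
      linear_combination h3 / 2
    have h5 : κ = vertexCoeff L μ ω := by exact_mod_cast h4
    rw [← h5]
    exact ⟨hκ, hκ'⟩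

end IsLadderEigenfunction

/-! ### Consequences for the point spectrum; simplicity. -/

section Spectrum

variable {L μ ω : ℝ}

theorem notMem_pointSpectrum_of_forall (hL : 0 < L) (hμ : 0 < μ) {z : ℂ}
    (h : ∀ (u : LadderL2 L μ) f f', u ∈ ladderSym L μ →
      IsLadderEigenfunction L μ z u f f' → u = 0) :
    z ∉ pointSpectrum (ladderSymOp L μ) := by
  intro hz
  obtain ⟨u, hu, hne⟩ := (mem_pointSpectrum_iff _ _).1 hz
  obtain ⟨f, f', hf⟩ := (mem_opEigenspace_ladderSymOp hL hμ z u).1 hu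
  exact hne (Subtype.ext (h u f f' u.2 hf))

theorem notMem_pointSpectrum_of_cos_eq_zero (hL : 0 < L) (hμ : 0 < μ) (hω : ω ≠ 0)
    (hs : Real.sin ω ≠ 0) (hC : Real.cos (ω * L / 2) = 0) :
    ((ω ^ 2 : ℝ) : ℂ) ∉ pointSpectrum (ladderSymOp L μ) :=
  notMem_pointSpectrum_of_forall hL hμ fun _ _ _ hu h =>
    h.eq_zero_of_cos_eq_zero hL hμ hu hω hs hC

theorem notMem_pointSpectrum_of_sin_eq_zero (hL : 0 < L) (hμ : 0 < μ) (hω : ω ≠ 0)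
    (hs : Real.sin ω = 0) (hC : Real.cos (ω * L / 2) ≠ 0) :
    ((ω ^ 2 : ℝ) : ℂ) ∉ pointSpectrum (ladderSymOp L μ) :=
  notMem_pointSpectrum_of_forall hL hμ fun _ _ _ hu h =>
    h.eq_zero_of_sin_eq_zero hL hμ hu hω hs hC

theorem dispersion_of_mem_pointSpectrum (hL : 0 < L) (hμ : 0 < μ) (hω : ω ≠ 0)
    (hs : Real.sin ω ≠ 0) (hC : Real.cos (ω * L / 2) ≠ 0)
    (h : ((ω ^ 2 : ℝ) : ℂ) ∈ pointSpectrum (ladderSymOp L μ)) :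
    |vertexCoeff L μ ω| < 1 ∧
      vertexCoeff L μ ω ^ 2 - 2 * vertexCoeff L 1 ω * vertexCoeff L μ ω + 1 = 0 := by
  by_contra hd
  refine notMem_pointSpectrum_of_forall hL hμ (fun u f f' hu hf => ?_) h
  by_contra hne
  exact hd (hf.dispersion hL hμ hu hω hs hC hne)

/-- In a gap of the unperturbed problem eigenvalues are simple. -/
theorem isSimpleEigenvalue_of_mem_pointSpectrum (hL : 0 < L) (hμ : 0 < μ) (hω : ω ≠ 0)
    (hs : Real.sin ω ≠ 0) (hC : Real.cos (ω * L / 2) ≠ 0)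
    (h : ((ω ^ 2 : ℝ) : ℂ) ∈ pointSpectrum (ladderSymOp L μ)) :
    IsSimpleEigenvalue (ladderSymOp L μ) ((ω ^ 2 : ℝ) : ℂ) := by
  obtain ⟨u, hu, hne⟩ := (mem_pointSpectrum_iff _ _).1 h
  obtain ⟨f, f', hf⟩ := (mem_opEigenspace_ladderSymOp hL hμ _ u).1 hu
  have h0 : f (rail true 0) ((0 : ℤ) : ℝ) ≠ 0 := fun h0 =>
    hne (Subtype.ext (hf.eq_zero_of_centre hL hμ u.2 hω hs hC h0))
  refine finrank_eq_one_iff_of_nonzero' (⟨u, hu⟩ : opEigenspace (ladderSymOp L μ) _)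
    (fun h1 => hne (congrArg Subtype.val h1)) |>.2 ?_
  rintro ⟨v, hv⟩
  obtain ⟨k, k', hk⟩ := (mem_opEigenspace_ladderSymOp hL hμ _ v).1 hv
  -- With this c the difference v − c • u vanishes at the central vertex.
  set c := k (rail true 0) ((0 : ℤ) : ℝ) / f (rail true 0) ((0 : ℤ) : ℝ) with hc
  refine ⟨c, ?_⟩
  have hw : v - c • u ∈ opEigenspace (ladderSymOp L μ) ((ω ^ 2 : ℝ) : ℂ) :=
    Submodule.sub_mem _ hv (Submodule.smul_mem _ c hu)
  obtain ⟨q, q', hq⟩ := (mem_opEigenspace_ladderSymOp hL hμ _ _).1 hw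
  have hrep : Represents L μ ((v - c • u : ladderSym L μ) : LadderL2 L μ)
      (fun e x => k e x + -c * f e x) := by
    have := hk.rep.add (hf.rep.smul (-c))
    rw [neg_smul, ← sub_eq_add_neg] at this
    exact this
  -- The representative q of the difference is chosen independently of k and f; continuity makes it
  -- agree with k − c f on the whole closed rail, its left end included.
  have heq : EqOn (q (rail true 0)) (fun x => k (rail true 0) x + -c * f (rail true 0) x)
      (Icc (lo L (rail true 0)) (hi L (rail true 0))) := by
    have hle := (lo_lt_hi hL (rail true 0)).le
    refine eqOn_Icc_of_ae_edge hL hμ ((hq.rep _).symm.trans (hrep _))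
      ((hq.helmholtz _).continuousOn hle) ?_
    exact ((hk.helmholtz _).continuousOn hle).add
      (continuousOn_const.mul ((hf.helmholtz _).continuousOn hle))
  have hq0 : q (rail true 0) ((0 : ℤ) : ℝ) = 0 := by
    rw [heq (by simp [lo, hi]), hc]
    field_simp
    ring
  have hz := hq.eq_zero_of_centre hL hμ (v - c • u).2 hω hs hC hq0
  have hz' : v - c • u = 0 := Subtype.ext hz
  exact Subtype.ext (sub_eq_zero.1 hz').symm

end Spectrum

/-! ### Construction of eigenfunctions. -/

/-- The position of an edge along the ladder. -/
def LadderEdge.pos : LadderEdge → ℤ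
  | rung j => j
  | rail _ j => j

/-- Each position carries three edges, labelled here by `Option Bool`. -/
theorem summable_comp_pos {b : ℤ → ℝ} (hb : Summable b) (hb0 : ∀ j, 0 ≤ b j) :
    Summable fun e : LadderEdge => b e.pos := by
  have h1 : Summable fun x : Option Bool × ℤ => (1 : ℝ) * b x.2 :=
    Summable.mul_of_nonneg (f := fun _ : Option Bool => (1 : ℝ)) (Summable.of_finite) hb
      (fun _ => zero_le_one) hb0
  let i : LadderEdge → Option Bool × ℤ := fun e => match e with
    | rung j => (none, j)
    | rail c j => (some c, j)
  have hi : Function.Injective i := by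
    rintro (j | ⟨c, j⟩) (k | ⟨d, k⟩) h <;> simp [i] at h ⊢ <;> exact h
  refine (h1.comp_injective hi).congr fun e => ?_
  cases e <;> simp [i, LadderEdge.pos]

theorem summable_sq_of_summable {b : ℤ → ℝ} (hb : Summable b) (hb0 : ∀ j, 0 ≤ b j) :
    Summable fun j => b j ^ 2 := by
  refine Summable.of_nonneg_of_le (fun j => sq_nonneg _) (fun j => ?_) (hb.mul_left (∑' j, b j))
  rw [sq]
  exact mul_le_mul_of_nonneg_right (hb.le_tsum j fun i _ => hb0 i) (hb0 j)

theorem edgeMeasure_univ_le {L μ : ℝ} (hL : 0 < L) (hμ : 0 < μ) (e : LadderEdge) :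
    edgeMeasure L μ e univ ≤ ENNReal.ofReal ((1 + μ) * (1 + L)) := by
  have h1 : edgeMeasure L μ e univ = ENNReal.ofReal (weight μ e * (hi L e - lo L e)) := by
    have hw : 0 ≤ weight μ e := by
      cases e with
      | rung j => simp only [weight]; split_ifs <;> linarith
      | rail b j => simp [weight]
    rw [edgeMeasure, ENNReal.ofReal_mul hw]
    simp
  rw [h1]
  apply ENNReal.ofReal_le_ofReal
  cases e with
  | rung j =>
    simp only [weight, hi, lo]
    split_ifs <;> nlinarith
  | rail b j =>
    simp only [weight, hi, lo]
    nlinarith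

instance isFiniteMeasure_edgeMeasure (L μ : ℝ) (e : LadderEdge) :
    IsFiniteMeasure (edgeMeasure L μ e) := by
  constructor
  rw [edgeMeasure]
  simp [ENNReal.mul_lt_top]

/-- Families of continuous functions with summable bounds represent elements of `L²`. -/
theorem exists_represents {L μ : ℝ} (hL : 0 < L) (hμ : 0 < μ) {F : LadderEdge → ℝ → ℂ}
    (hF : ∀ e, Continuous (F e)) {b : ℤ → ℝ} (hb : Summable b) (hb0 : ∀ j, 0 ≤ b j)
    (hFb : ∀ e x, ‖F e x‖ ≤ b e.pos) : ∃ u : LadderL2 L μ, Represents L μ u F := by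
  have hm : ∀ e, MemLp (F e) 2 (edgeMeasure L μ e) := fun e =>
    MemLp.of_bound (hF e).aestronglyMeasurable (b e.pos) (Filter.Eventually.of_forall (hFb e))
  -- M bounds the mass of every edge, whether its weight is 1 or μ and its length 1 or L.
  set M : ℝ := (1 + μ) * (1 + L)
  have hnorm : ∀ e, ‖(hm e).toLp (F e)‖ ≤ M ^ (2⁻¹ : ℝ) * b e.pos := by
    intro e
    refine (Lp.norm_le_of_ae_bound (hb0 e.pos) ?_).trans ?_
    · filter_upwards [(hm e).coeFn_toLp] with x hx
      rw [hx]
      exact hFb e x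
    · refine mul_le_mul_of_nonneg_right ?_ (hb0 _)
      simp only [ENNReal.toReal_ofNat]
      refine Real.rpow_le_rpow (by positivity) ?_ (by norm_num)
      have := ENNReal.toReal_mono ENNReal.ofReal_ne_top (edgeMeasure_univ_le hL hμ e)
      rw [ENNReal.toReal_ofReal (by positivity)] at this
      exact this
  have hmem : Memℓp (fun e => (hm e).toLp (F e)) 2 := by
    refine memℓp_gen ?_
    simp only [ENNReal.toReal_ofNat, Real.rpow_ofNat]
    refine Summable.of_nonneg_of_le (fun e => by positivity) (fun e => ?_)
      ((summable_comp_pos (summable_sq_of_summable hb hb0) fun j => sq_nonneg _).mul_left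
        ((M ^ (2⁻¹ : ℝ)) ^ 2))
    rw [← mul_pow]
    exact pow_le_pow_left₀ (norm_nonneg _) (hnorm e) 2
  exact ⟨⟨_, hmem⟩, fun e => (hm e).coeFn_toLp⟩

/-- The functions on the ladder built from `cos` on the rungs and from `cos` and `sin` on the
rails. -/
def ladderWave (ω : ℝ) (c p q : ℤ → ℂ) : LadderEdge → ℝ → ℂ
  | rung j, y => c j * Real.cos (ω * y)
  | rail _ j, x => p j * Real.cos (ω * (x - j)) + q j * Real.sin (ω * (x - j))

/-- The edgewise derivative of `ladderWave`. -/
def ladderWaveDeriv (ω : ℝ) (c p q : ℤ → ℂ) : LadderEdge → ℝ → ℂ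
  | rung j, y => -ω * c j * Real.sin (ω * y)
  | rail _ j, x => ω * (-p j * Real.sin (ω * (x - j)) + q j * Real.cos (ω * (x - j)))

theorem hasDerivAt_cos_mul_sub (ω t y : ℝ) :
    HasDerivAt (fun y : ℝ => ((Real.cos (ω * (y - t)) : ℝ) : ℂ))
      ((-Real.sin (ω * (y - t)) * ω : ℝ) : ℂ) y := by
  have hlin : HasDerivAt (fun y : ℝ => ω * (y - t)) ω y := by
    simpa using ((hasDerivAt_id y).sub_const t).const_mul ω
  exact hlin.cos.ofReal_comp

theorem hasDerivAt_sin_mul_sub (ω t y : ℝ) :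
    HasDerivAt (fun y : ℝ => ((Real.sin (ω * (y - t)) : ℝ) : ℂ))
      ((Real.cos (ω * (y - t)) * ω : ℝ) : ℂ) y := by
  have hlin : HasDerivAt (fun y : ℝ => ω * (y - t)) ω y := by
    simpa using ((hasDerivAt_id y).sub_const t).const_mul ω
  exact hlin.sin.ofReal_comp

section Wave

variable {L μ ω : ℝ} {c p q : ℤ → ℂ}

theorem continuous_ladderWave (e : LadderEdge) : Continuous (ladderWave ω c p q e) := by
  cases e <;> (unfold ladderWave; fun_prop)

theorem continuous_ladderWaveDeriv (e : LadderEdge) : Continuous (ladderWaveDeriv ω c p q e) := by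
  cases e <;> (unfold ladderWaveDeriv; fun_prop)

theorem hasDerivAt_ladderWave (e : LadderEdge) (x : ℝ) :
    HasDerivAt (ladderWave ω c p q e) (ladderWaveDeriv ω c p q e x) x := by
  cases e with
  | rung j =>
    have h := (hasDerivAt_cos_mul_sub ω 0 x).const_mul (c j)
    simp only [sub_zero] at h
    refine h.congr_deriv ?_
    simp only [ladderWaveDeriv]
    push_cast
    ring
  | rail b j =>
    refine (((hasDerivAt_cos_mul_sub ω j x).const_mul (p j)).add
      ((hasDerivAt_sin_mul_sub ω j x).const_mul (q j))).congr_deriv ?_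
    simp only [ladderWaveDeriv]
    push_cast
    ring

theorem hasDerivAt_ladderWaveDeriv (e : LadderEdge) (x : ℝ) :
    HasDerivAt (ladderWaveDeriv ω c p q e)
      (-((ω ^ 2 : ℝ) : ℂ) * ladderWave ω c p q e x) x := by
  cases e with
  | rung j =>
    have h := (hasDerivAt_sin_mul_sub ω 0 x).const_mul (-ω * c j)
    simp only [sub_zero] at h
    refine h.congr_deriv ?_
    simp only [ladderWave]
    push_cast
    ring
  | rail b j =>
    refine ((((hasDerivAt_sin_mul_sub ω j x).const_mul (-p j)).add
      ((hasDerivAt_cos_mul_sub ω j x).const_mul (q j))).const_mul (ω : ℂ)).congr_deriv ?_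
    simp only [ladderWave]
    push_cast
    ring

theorem isHelmholtzOn_ladderWave (a b : ℝ) (e : LadderEdge) :
    IsHelmholtzOn ((ω ^ 2 : ℝ) : ℂ) a b (ladderWave ω c p q e) (ladderWaveDeriv ω c p q e) :=
  ⟨isPrimitiveOn_of_hasDerivAt (continuous_ladderWaveDeriv e) (hasDerivAt_ladderWave e),
    isPrimitiveOn_of_hasDerivAt (continuous_const.mul (continuous_ladderWave e))
      (hasDerivAt_ladderWaveDeriv e)⟩

theorem norm_mul_ofReal_le {z : ℂ} {t B : ℝ} (hz : ‖z‖ ≤ B) (ht : |t| ≤ 1) : ‖z * t‖ ≤ B := by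
  rw [norm_mul, Complex.norm_real, Real.norm_eq_abs]
  exact (mul_le_of_le_one_right (norm_nonneg _) ht).trans hz

theorem norm_ladderWave_le {b : ℤ → ℝ} (hc : ∀ j, ‖c j‖ ≤ b j) (hp : ∀ j, ‖p j‖ ≤ b j)
    (hq : ∀ j, ‖q j‖ ≤ b j) (e : LadderEdge) (x : ℝ) :
    ‖ladderWave ω c p q e x‖ ≤ 2 * b e.pos := by
  cases e with
  | rung j =>
    have h1 := norm_mul_ofReal_le (hc j) (Real.abs_cos_le_one (ω * x))
    have h2 := (norm_nonneg _).trans (hc j)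
    simp only [ladderWave, LadderEdge.pos]
    linarith
  | rail a j =>
    have h1 := norm_mul_ofReal_le (hp j) (Real.abs_cos_le_one (ω * (x - j)))
    have h2 := norm_mul_ofReal_le (hq j) (Real.abs_sin_le_one (ω * (x - j)))
    simp only [ladderWave, LadderEdge.pos]
    exact (norm_add_le _ _).trans (by linarith)

theorem norm_ladderWaveDeriv_le {b : ℤ → ℝ} (hc : ∀ j, ‖c j‖ ≤ b j) (hp : ∀ j, ‖p j‖ ≤ b j)
    (hq : ∀ j, ‖q j‖ ≤ b j) (e : LadderEdge) (x : ℝ) :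
    ‖ladderWaveDeriv ω c p q e x‖ ≤ |ω| * (2 * b e.pos) := by
  have hω : ‖(ω : ℂ)‖ = |ω| := by rw [Complex.norm_real, Real.norm_eq_abs]
  cases e with
  | rung j =>
    have h1 := norm_mul_ofReal_le (hc j) (Real.abs_sin_le_one (ω * x))
    have h2 := (norm_nonneg _).trans (hc j)
    simp only [ladderWaveDeriv, LadderEdge.pos]
    rw [mul_assoc, norm_mul, norm_neg, hω]
    exact mul_le_mul_of_nonneg_left (by linarith) (abs_nonneg _)
  | rail a j =>
    have h1 := norm_mul_ofReal_le ((norm_neg (p j)).trans_le (hp j))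
      (Real.abs_sin_le_one (ω * (x - j)))
    have h2 := norm_mul_ofReal_le (hq j) (Real.abs_cos_le_one (ω * (x - j)))
    simp only [ladderWaveDeriv, LadderEdge.pos]
    rw [norm_mul, hω]
    exact mul_le_mul_of_nonneg_left ((norm_add_le _ _).trans (by linarith)) (abs_nonneg _)

/-- A decaying wave which is continuous and satisfies Kirchhoff's conditions is an
eigenfunction. -/
theorem exists_eigenfunction_ladderWave (hL : 0 < L) (hμ : 0 < μ) {b : ℤ → ℝ} (hb : Summable b)
    (hc : ∀ j, ‖c j‖ ≤ b j) (hp : ∀ j, ‖p j‖ ≤ b j) (hq : ∀ j, ‖q j‖ ≤ b j)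
    (h1 : ∀ j, c j * Real.cos (ω * L / 2) = p j)
    (h2 : ∀ j, p j * Real.cos ω + q j * Real.sin ω = p (j + 1))
    (h3 : ∀ j, weight μ (rung j) * Real.sin (ω * L / 2) * c j + q j
      = -p (j - 1) * Real.sin ω + q (j - 1) * Real.cos ω) :
    ∃ u ∈ opEigenspace (ladderSymOp L μ) ((ω ^ 2 : ℝ) : ℂ),
      Represents L μ u (ladderWave ω c p q) := by
  have hb0 : ∀ j, 0 ≤ b j := fun j => (norm_nonneg _).trans (hc j)
  obtain ⟨u, hu⟩ := exists_represents hL hμ (F := ladderWave ω c p q) continuous_ladderWave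
    (hb.mul_left 2) (fun j => mul_nonneg zero_le_two (hb0 j)) (norm_ladderWave_le hc hp hq)
  obtain ⟨u', hu'⟩ := exists_represents hL hμ (F := ladderWaveDeriv ω c p q)
    continuous_ladderWaveDeriv ((hb.mul_left 2).mul_left |ω|)
    (fun j => mul_nonneg (abs_nonneg _) (mul_nonneg zero_le_two (hb0 j)))
    (norm_ladderWaveDeriv_le hc hp hq)
  have hsym : u ∈ ladderSym L μ :=
    ⟨ladderWave ω c p q, hu, fun j y => by simp [ladderWave], fun j x => rfl⟩
  have hright : ∀ j : ℤ, (j : ℝ) - ((j - 1 : ℤ) : ℝ) = 1 := fun j => by push_cast; ring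
  have h1' : ∀ j, c j * Complex.cos (ω * L / 2) = p j := fun j => by simpa using h1 j
  have hang : (ω : ℂ) * (L / 2) = ω * L / 2 := by ring
  refine ⟨⟨u, hsym⟩, (mem_opEigenspace_ladderSymOp hL hμ _ _).2 ⟨ladderWave ω c p q,
    ladderWaveDeriv ω c p q, hu, ⟨u', hu'⟩, fun e => isHelmholtzOn_ladderWave _ _ e, ?_, ?_⟩, hu⟩
  · intro j
    have h4 := h2 (j - 1)
    rw [sub_add_cancel] at h4
    have h5 : p (j - 1) * Complex.cos ω + q (j - 1) * Complex.sin ω = p j := by simpa using h4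
    simp [ladderWave, hang, h1', h5]
  · intro j
    have h4 : (weight μ (rung j) : ℂ) * Complex.sin (ω * L / 2) * c j + q j
        = -p (j - 1) * Complex.sin ω + q (j - 1) * Complex.cos ω := by simpa using h3 j
    have h5 : (weight μ (rail true j) : ℂ) = 1 ∧ (weight μ (rail true (j - 1)) : ℂ) = 1 ∧
      (weight μ (rail false j) : ℂ) = 1 ∧ (weight μ (rail false (j - 1)) : ℂ) = 1 := by
      simp [weight]
    rw [h5.1, h5.2.1, h5.2.2.1, h5.2.2.2]
    simp only [ladderWaveDeriv, hright]
    push_cast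
    simp only [hang, mul_one, sub_self, mul_zero, mul_neg, Complex.sin_neg, Complex.sin_zero,
      Complex.cos_zero]
    -- By symmetry both vertices of a rung give the same equation, and `h3` is Kirchhoff's condition
    -- divided by ω.
    constructor <;> linear_combination (ω : ℂ) * h4

theorem Represents.eq_zero_of_zero (hL : 0 < L) (hμ : 0 < μ) {F : LadderEdge → ℝ → ℂ}
    {e : LadderEdge} (hF : Continuous (F e)) {u : LadderL2 L μ} (hu : Represents L μ u F)
    (h0 : u e = 0) {x : ℝ} (hx : x ∈ Icc (lo L e) (hi L e)) : F e x = 0 := by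
  have h1 := hu e
  rw [h0] at h1
  exact eqOn_Icc_of_ae_edge hL hμ (h1.symm.trans (Represents.zero e)) hF.continuousOn
    continuousOn_const hx

end Wave

theorem summable_pow_natAbs {r : ℝ} (h0 : 0 ≤ r) (h1 : r < 1) :
    Summable fun j : ℤ => r ^ j.natAbs := by
  refine Summable.of_nat_of_neg ?_ ?_ <;> simpa using summable_geometric_of_lt_one h0 h1

section Geometric

variable {L μ ω : ℝ}

/-- The dispersion relation is sufficient for an eigenvalue. -/
theorem mem_pointSpectrum_of_dispersion (hL : 0 < L) (hμ : 0 < μ)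
    (hs : Real.sin ω ≠ 0) (hC : Real.cos (ω * L / 2) ≠ 0)
    (h1 : |vertexCoeff L μ ω| < 1)
    (h2 : vertexCoeff L μ ω ^ 2 - 2 * vertexCoeff L 1 ω * vertexCoeff L μ ω + 1 = 0) :
    ((ω ^ 2 : ℝ) : ℂ) ∈ pointSpectrum (ladderSymOp L μ) := by
  set κ := vertexCoeff L μ ω with hκ
  set C := Real.cos (ω * L / 2) with hCdef
  set S := Real.sin (ω * L / 2) with hSdef
  have hv : ∀ w, vertexCoeff L w ω = Real.cos ω - w / 2 * (Real.sin ω * (S / C)) := fun w => by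
    rw [vertexCoeff, Real.tan_eq_sin_div_cos]
  -- Off the centre the recursion for this profile is a multiple of `h2`; at the centre it is 2κ = 2
  -- g_μ, true by the choice of κ.
  let p : ℤ → ℝ := fun j => κ ^ j.natAbs
  have hrec : ∀ j : ℤ, p (j + 1) + p (j - 1)
      = 2 * vertexCoeff L (weight μ (rung j)) ω * p j := by
    intro j
    rcases lt_trichotomy j 0 with hj | rfl | hj
    · obtain ⟨n, rfl⟩ : ∃ n : ℕ, j = -(n + 1 : ℤ) := ⟨(-j - 1).toNat, by omega⟩
      have e1 : (-(n + 1 : ℤ) + 1).natAbs = n := by omega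
      have e2 : (-(n + 1 : ℤ) - 1).natAbs = n + 2 := by omega
      have e3 : (-(n + 1 : ℤ)).natAbs = n + 1 := by omega
      simp only [p, weight, if_neg hj.ne, e1, e2, e3]
      linear_combination κ ^ n * h2
    · simp only [p, weight]
      simp [← hκ]
      ring
    · obtain ⟨n, rfl⟩ : ∃ n : ℕ, j = (n + 1 : ℤ) := ⟨(j - 1).toNat, by omega⟩
      have e1 : ((n + 1 : ℤ) + 1).natAbs = n + 2 := by omega
      have e2 : ((n + 1 : ℤ) - 1).natAbs = n := by omega
      have e3 : ((n + 1 : ℤ)).natAbs = n + 1 := by omega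
      simp only [p, weight, if_neg hj.ne', e1, e2, e3]
      linear_combination κ ^ n * h2
  -- Continuity at the two ends of an edge dictates the amplitudes c and q.
  let c : ℤ → ℝ := fun j => p j / C
  let q : ℤ → ℝ := fun j => (p (j + 1) - p j * Real.cos ω) / Real.sin ω
  have hsum : Summable fun j : ℤ => |p j| := by
    simpa [p, abs_pow] using summable_pow_natAbs (abs_nonneg κ) h1
  have hsum' : Summable fun j : ℤ => |p (j + 1)| :=
    hsum.comp_injective (add_left_injective 1)
  let b : ℤ → ℝ := fun j => (1 + |C|⁻¹ + |Real.sin ω|⁻¹) * (|p j| + |p (j + 1)|)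
  have hC0 : 0 ≤ |C|⁻¹ := by positivity
  have hs0 : 0 ≤ |Real.sin ω|⁻¹ := by positivity
  have hpb : ∀ j, |p j| ≤ b j := fun j => by
    have : b j = |p j| + (|p (j + 1)| + (|C|⁻¹ + |Real.sin ω|⁻¹) * (|p j| + |p (j + 1)|)) := by
      simp only [b]; ring
    rw [this]
    have : 0 ≤ |p (j + 1)| + (|C|⁻¹ + |Real.sin ω|⁻¹) * (|p j| + |p (j + 1)|) := by positivity
    linarith
  have hcb : ∀ j, |c j| ≤ b j := fun j => by
    have : b j = |C|⁻¹ * |p j| + (|C|⁻¹ * |p (j + 1)|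
        + (1 + |Real.sin ω|⁻¹) * (|p j| + |p (j + 1)|)) := by
      simp only [b]; ring
    rw [this]
    have h0 : 0 ≤ |C|⁻¹ * |p (j + 1)| + (1 + |Real.sin ω|⁻¹) * (|p j| + |p (j + 1)|) := by
      positivity
    simp only [c, abs_div]
    rw [div_eq_inv_mul]
    linarith
  have hqb : ∀ j, |q j| ≤ b j := fun j => by
    have : b j = |Real.sin ω|⁻¹ * (|p (j + 1)| + |p j|)
        + (1 + |C|⁻¹) * (|p j| + |p (j + 1)|) := by
      simp only [b]; ring
    rw [this]
    have h0 : 0 ≤ (1 + |C|⁻¹) * (|p j| + |p (j + 1)|) := by positivity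
    have h3 : |p (j + 1) - p j * Real.cos ω| ≤ |p (j + 1)| + |p j| := by
      refine (abs_sub _ _).trans (add_le_add le_rfl ?_)
      rw [abs_mul]
      exact mul_le_of_le_one_right (abs_nonneg _) (Real.abs_cos_le_one ω)
    simp only [q, abs_div]
    rw [div_eq_inv_mul]
    have := mul_le_mul_of_nonneg_left h3 hs0
    linarith
  obtain ⟨u, hu, hrep⟩ := exists_eigenfunction_ladderWave (L := L) (μ := μ) (ω := ω) hL hμ
    (c := fun j => (c j : ℂ)) (p := fun j => (p j : ℂ)) (q := fun j => (q j : ℂ)) (b := b)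
    ((hsum.add hsum').mul_left _) (fun j => by simpa using hcb j) (fun j => by simpa using hpb j)
    (fun j => by simpa using hqb j)
    (fun j => by
      rw [← hCdef, ← Complex.ofReal_mul]
      congr 1
      simp only [c]
      field_simp)
    (fun j => by
      rw [← Complex.ofReal_mul, ← Complex.ofReal_mul, ← Complex.ofReal_add]
      congr 1
      simp only [q]
      field_simp
      ring)
    (fun j => by
      have h3 := hrec j
      rw [hv] at h3
      have hr : weight μ (rung j) * S * c j + q j
          = -p (j - 1) * Real.sin ω + q (j - 1) * Real.cos ω := by
        have hcs := Real.cos_sq_add_sin_sq ω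
        simp only [c, q, sub_add_cancel]
        apply mul_left_cancel₀ hs
        have e1 : Real.sin ω * ((p (j + 1) - p j * Real.cos ω) / Real.sin ω)
          = p (j + 1) - p j * Real.cos ω := by field_simp
        have e2 : Real.sin ω * ((p j - p (j - 1) * Real.cos ω) / Real.sin ω)
          = p j - p (j - 1) * Real.cos ω := by field_simp
        have e3 : S * (p j / C) = S / C * p j := by ring
        linear_combination h3 + e1 - Real.cos ω * e2 + p (j - 1) * hcs
      exact_mod_cast congrArg (fun t : ℝ => (t : ℂ)) hr)
  refine (mem_pointSpectrum_iff _ _).2 ⟨u, hu, ?_⟩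
  rintro rfl
  have h3 := hrep.eq_zero_of_zero hL hμ (e := rail true 0) (continuous_ladderWave _) rfl (x := 0)
    (by simp [lo, hi])
  simp [ladderWave, p] at h3

/-- Where both `sin ω` and `cos (ω L / 2)` vanish the operator has a flat band. -/
theorem not_finiteDimensional_eigenspace (hL : 0 < L) (hμ : 0 < μ) (hω : ω ≠ 0)
    (hs : Real.sin ω = 0) (hC : Real.cos (ω * L / 2) = 0) :
    ¬ FiniteDimensional ℂ (opEigenspace (ladderSymOp L μ) ((ω ^ 2 : ℝ) : ℂ)) := by
  have hS : Real.sin (ω * L / 2) ≠ 0 := by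
    intro h
    have := Real.cos_sq_add_sin_sq (ω * L / 2)
    rw [h, hC] at this
    norm_num at this
  have hS' : Complex.sin (ω * L / 2) ≠ 0 := by exact_mod_cast hS
  have hw : ∀ j, (weight μ (rung j) : ℂ) ≠ 0 := fun j => by
    simp only [weight]
    split_ifs
    · exact_mod_cast hμ.ne'
    · simp
  have hex : ∀ m : ℤ, ∃ u : opEigenspace (ladderSymOp L μ) ((ω ^ 2 : ℝ) : ℂ), ∃ c : ℤ → ℂ,
      Represents L μ ((u : ladderSym L μ) : LadderL2 L μ)
        (ladderWave ω c (fun _ => 0) (Pi.single m 1)) := by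
    intro m
    -- The function sin(ω(x − m)) on the two rails of cell m vanishes at the vertices, and so do all
    -- rung waves. The rungs m and m + 1 are given the amplitudes that balance the derivatives.
    let q : ℤ → ℂ := Pi.single m 1
    let c : ℤ → ℂ := fun j => (q (j - 1) * Real.cos ω - q j)
      / (weight μ (rung j) * Real.sin (ω * L / 2))
    have hq : ∀ j, j ≠ m → q j = 0 := fun j hj => Pi.single_eq_of_ne hj 1
    have hsum : Summable fun j => ‖c j‖ + ‖q j‖ := by
      refine summable_of_ne_finset_zero (s := {m, m + 1}) fun j hj => ?_
      simp only [Finset.mem_insert, Finset.mem_singleton, not_or] at hj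
      have h1 : q j = 0 := hq j hj.1
      have h2 : q (j - 1) = 0 := hq _ (by omega)
      simp [c, h1, h2]
    obtain ⟨u, hu, hrep⟩ := exists_eigenfunction_ladderWave (L := L) (μ := μ) (ω := ω) hL hμ
      (c := c) (p := fun _ => 0) (q := q) hsum (fun j => by simp) (fun j => by simp; positivity)
      (fun j => by simp) (fun j => by simp [hC])
      (fun j => by rw [hs]; simp) (fun j => by
        rw [hs]
        simp only [c]
        have := hw j
        push_cast
        field_simp
        ring)
    exact ⟨⟨u, hu⟩, c, hrep⟩
  choose v c hv using hex
  intro hfin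
  have hli : LinearIndependent ℂ v := by
    rw [linearIndependent_iff']
    intro s g hg m hm
    -- Restriction to the upper rail of cell m kills every `v i` except `v m`.
    let T : opEigenspace (ladderSymOp L μ) ((ω ^ 2 : ℝ) : ℂ)
        →ₗ[ℂ] Lp ℂ 2 (edgeMeasure L μ (rail true m)) :=
      { toFun := fun u => ((u : ladderSym L μ) : LadderL2 L μ) (rail true m)
        map_add' := fun _ _ => rfl
        map_smul' := fun _ _ => rfl }
    have h0 : ∀ i ≠ m, T (v i) = 0 := by
      intro i hi
      refine Lp.ext ((hv i (rail true m)).trans (Filter.EventuallyEq.trans ?_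
        (Represents.zero (rail true m)).symm))
      refine Filter.Eventually.of_forall fun x => ?_
      simp [ladderWave, Pi.single_eq_of_ne hi.symm]
    have h1 : T (v m) ≠ 0 := by
      intro h
      have h2 : ∀ x ∈ Icc (m : ℝ) (m + 1), Real.sin (ω * (x - m)) = 0 := by
        intro x hx
        have := (hv m).eq_zero_of_zero hL hμ (e := rail true m) (continuous_ladderWave _) h hx
        simp only [ladderWave, zero_mul, Pi.single_eq_same, one_mul, zero_add] at this
        exact_mod_cast this
      -- The point m + δ lies on the rail and 0 < |ω|δ < π, so the sine is nonzero there.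
      set δ : ℝ := min 1 (Real.pi / (2 * |ω|)) with hδ
      have hω' : 0 < |ω| := abs_pos.2 hω
      have hδ0 : 0 < δ := lt_min one_pos (by positivity)
      have h3 := h2 (m + δ) ⟨by linarith, by linarith [min_le_left 1 (Real.pi / (2 * |ω|))]⟩
      rw [add_sub_cancel_left] at h3
      have h4 : Real.sin (|ω| * δ) = 0 := by
        rcases abs_choice ω with h | h <;> rw [h]
        · exact h3
        · rw [neg_mul, Real.sin_neg, h3, neg_zero]
      have h5 : |ω| * δ < Real.pi := by
        have := mul_le_mul_of_nonneg_left (min_le_right 1 (Real.pi / (2 * |ω|))) hω'.le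
        have h6 : |ω| * (Real.pi / (2 * |ω|)) = Real.pi / 2 := by field_simp
        rw [h6] at this
        linarith [Real.pi_pos]
      exact (Real.sin_pos_of_pos_of_lt_pi (by positivity) h5).ne' h4
    have h2 := congrArg T hg
    rw [map_sum, map_zero, Finset.sum_eq_single m] at h2
    · rw [map_smul, smul_eq_zero] at h2
      exact h2.resolve_right h1
    · intro i _ hi
      rw [map_smul, h0 i hi, smul_zero]
    · exact fun h => absurd hm h
  have := hli.finite
  exact not_finite ℤ

end Geometric

/-! ### Bands belong to the essential spectrum. -/

section Band

variable {L μ ω : ℝ}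

/-- The bands: the points where the coefficient of the unperturbed recursion is at most one in
absolute value belong to the essential spectrum. -/
theorem mem_essentialSpectrum_of_band (hL : 0 < L) (hμ : 0 < μ) (hω : ω ≠ 0)
    (hs : Real.sin ω ≠ 0) (hC : Real.cos (ω * L / 2) ≠ 0) (hg : |vertexCoeff L 1 ω| ≤ 1) :
    ((ω ^ 2 : ℝ) : ℂ) ∈ essentialSpectrum (ladderSymOp L μ) := by
  have hno : ∀ κ : ℝ, |κ| < 1 → κ ^ 2 - 2 * vertexCoeff L 1 ω * κ + 1 ≠ 0 := fun κ h1 h2 =>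
    absurd (one_lt_abs_of_decaying_root h1 h2) (not_lt.2 hg)
  refine ⟨?_, fun hd => ?_⟩
  swap
  · obtain ⟨h1, h2⟩ := dispersion_of_mem_pointSpectrum hL hμ hω hs hC hd.2.2.1
    exact hno _ h1 h2
  rintro ⟨R, hR, -⟩
  -- The source is cos(ωy) on the central rung and zero elsewhere. It is shown not to lie in the
  -- range of A − ω², so surjectivity already fails.
  set c : ℤ → ℂ := Pi.single 0 1 with hc
  set F := ladderWave ω c 0 0 with hF
  have hFrung : ∀ j ≠ 0, ∀ y, F (rung j) y = 0 := fun j hj y => by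
    simp [hF, hc, ladderWave, Pi.single_eq_of_ne hj]
  have hFrail : ∀ b j y, F (rail b j) y = 0 := fun b j y => by simp [hF, ladderWave]
  have hF0 : ∀ y, F (rung 0) y = Real.cos (ω * y) := fun y => by simp [hF, hc, ladderWave]
  have hsum : Summable fun j => ‖c j‖ := by
    refine summable_of_ne_finset_zero (s := {0}) fun j hj => ?_
    simp only [Finset.mem_singleton] at hj
    simp [hc, Pi.single_eq_of_ne hj]
  obtain ⟨v, hv⟩ := exists_represents hL hμ (F := F) continuous_ladderWave
    (hsum.mul_left 2) (fun j => by positivity)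
    (norm_ladderWave_le (fun j => le_rfl) (fun j => by simp) (fun j => by simp))
  have hvsym : v ∈ ladderSym L μ := ⟨F, hv, fun j y => by simp [hF, ladderWave], fun j x => rfl⟩
  obtain ⟨hdom, hAu⟩ := hR ⟨v, hvsym⟩
  set u := R ⟨v, hvsym⟩ with hu
  have hgr : (u, (⟨v, hvsym⟩ : ladderSym L μ) + ((ω ^ 2 : ℝ) : ℂ) • u)
      ∈ (ladderSymOp L μ).graph := by
    rw [LinearPMap.mem_graph_iff]
    exact ⟨⟨u, hdom⟩, rfl, sub_eq_iff_eq_add.1 hAu⟩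
  rw [ladderSymOp_graph hL hμ] at hgr
  obtain ⟨f, f', f'', h⟩ := hgr
  have hprim : ∀ e, IsPrimitiveOn (lo L e) (hi L e) (f' e)
      (fun x => -F e x + -((ω ^ 2 : ℝ) : ℂ) * f e x) := by
    intro e
    refine (h.prim' e).congr_ae (lo_lt_hi hL e).le (ae_edge hμ (L := L) (e := e) ?_)
    filter_upwards [(h.rep_second e).symm.trans ((hv.add (h.rep.smul ((ω ^ 2 : ℝ) : ℂ))) e)]
      with x hx
    linear_combination -hx
  have hcont : ∀ e, ContinuousOn (f e) (Icc (lo L e) (hi L e)) := fun e =>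
    (h.prim e).continuousOn (lo_lt_hi hL e).le
  have hsymm := symmetric_of_represents hL hμ u.2 h.rep hcont
  obtain ⟨u', hu'⟩ := h.rep_deriv
  -- Away from the source u solves the homogeneous equation, so the vertex analysis applies; as
  -- nothing decays in a band, u vanishes on the rails and has zero Cauchy data at both ends of rung
  -- 0.
  have ho : IsOffCentreSolution L μ ω f f' :=
    { helmholtz_rail := fun b j => ⟨h.prim (rail b j), by
        simpa [hFrail, lo, hi] using hprim (rail b j)⟩
      helmholtz_rung := fun j hj => ⟨h.prim (rung j), by
        simpa [hFrung j hj, lo, hi] using hprim (rung j)⟩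
      even := hsymm.1
      cont := h.cont
      kirchhoff := h.kirchhoff
      tendsto := tendsto_left_zero h.rep hu' true fun j => h.prim (rail true j) }
  have h0 : ∀ j : ℤ, f (rail true j) j = 0 := by
    rcases ho.vertex_values hL hω hC with h1 | ⟨-, κ, h1, h2, -⟩
    · exact h1
    · exact absurd h2 (hno κ h1)
  obtain ⟨hd1, hd2⟩ := ho.deriv_rung_eq_zero hμ 0 (ho.deriv_rail_eq_zero hL hω hs h0)
  have hle : -(L / 2) ≤ L / 2 := by linarith
  have hv1 : f (rung 0) (L / 2) = 0 := by rw [ho.rung_eq, h0]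
  have hv2 : f (rung 0) (-(L / 2)) = 0 := by rw [ho.even 0 _ ⟨hle, le_rfl⟩, hv1]
  have hcf : ContinuousOn (f (rung 0)) (Icc (-(L / 2)) (L / 2)) := hcont (rung 0)
  have hcf' : ContinuousOn (f' (rung 0)) (Icc (-(L / 2)) (L / 2)) :=
    (h.prim' (rung 0)).continuousOn hle
  have hcF : Continuous (F (rung 0)) := continuous_ladderWave _
  -- Testing the equation on rung 0 against cos(ωy): the Wronskian vanishes at both ends, yet its
  -- derivative is −cos²(ωy).
  have hder : ∀ y ∈ Ioo (-(L / 2)) (L / 2),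
      HasDerivAt (fun y : ℝ => f' (rung 0) y * ((Real.cos (ω * y) : ℝ) : ℂ)
        + ω * f (rung 0) y * ((Real.sin (ω * y) : ℝ) : ℂ))
        ((-(Real.cos (ω * y) ^ 2) : ℝ) : ℂ) y := by
    intro y hy
    have d1 : HasDerivAt (f (rung 0)) (f' (rung 0) y) y :=
      (h.prim (rung 0)).hasDerivAt hcf' hy
    have d2 : HasDerivAt (f' (rung 0)) (-F (rung 0) y + -((ω ^ 2 : ℝ) : ℂ) * f (rung 0) y) y :=
      (hprim (rung 0)).hasDerivAt (hcF.continuousOn.neg.add (continuousOn_const.mul hcf)) hy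
    have d3 := hasDerivAt_cos_mul_sub ω 0 y
    have d4 := hasDerivAt_sin_mul_sub ω 0 y
    simp only [sub_zero] at d3 d4
    refine ((d2.mul d3).add ((d1.const_mul (ω : ℂ)).mul d4)).congr_deriv ?_
    rw [hF0]
    push_cast
    ring
  have hint := intervalIntegral.integral_eq_sub_of_hasDerivAt_of_le hle (by fun_prop) hder
    (Continuous.intervalIntegrable (by fun_prop) _ _)
  rw [hd1, hd2, hv1, hv2, intervalIntegral.integral_ofReal, intervalIntegral.integral_neg] at hint
  have hpos : 0 < ∫ y in (-(L / 2))..(L / 2), Real.cos (ω * y) ^ 2 := by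
    refine intervalIntegral.integral_pos (by linarith) (by fun_prop) (fun y _ => sq_nonneg _)
      ⟨0, ⟨by linarith, by linarith⟩, by simp⟩
  simp only [zero_mul, mul_zero, add_zero, sub_zero, Complex.ofReal_eq_zero, neg_eq_zero] at hint
  exact hpos.ne' hint

end Band

/-! ### Eigenvalues are positive. -/

section Positivity

variable {L μ : ℝ} {z : ℂ} {u : LadderL2 L μ} {f f' : LadderEdge → ℝ → ℂ}

/-- The energy density `α |f'|² + β |f|²` has zero integral only if it vanishes. -/
theorem eqOn_zero_of_integral_eq_zero {a b α β : ℝ} (hab : a < b) (hα : 0 ≤ α) (hβ : 0 ≤ β)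
    {k k' : ℝ → ℂ} (hk : ContinuousOn k (Icc a b)) (hk' : ContinuousOn k' (Icc a b))
    (h : ∫ x in a..b, (α * ‖k' x‖ ^ 2 + β * ‖k x‖ ^ 2) = 0) :
    ∀ x ∈ Icc a b, α * ‖k' x‖ ^ 2 + β * ‖k x‖ ^ 2 = 0 := by
  intro x hx
  by_contra hne
  have hnn : ∀ y, 0 ≤ α * ‖k' y‖ ^ 2 + β * ‖k y‖ ^ 2 := fun y => by positivity
  exact (intervalIntegral.integral_pos hab (by fun_prop) (fun y _ => hnn y)
    ⟨x, hx, lt_of_le_of_ne (hnn x) (Ne.symm hne)⟩).ne' h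

/-- A rotation by θ makes the real part of |f'|² − z|f|² a nonnegative form unless z > 0: θ = ±i for
non-real z, θ = 1 for z ≤ 0. For z = 0 only the coefficient of |f'|² survives. -/
theorem exists_energy_direction {z : ℂ} (hz : ∀ ω : ℝ, 0 < ω → z ≠ ((ω ^ 2 : ℝ) : ℂ)) :
    ∃ (θ : ℂ) (α β : ℝ), 0 ≤ α ∧ 0 ≤ β ∧ (α ≠ 0 ∨ β ≠ 0) ∧
      ∀ p q : ℝ, (θ * ((p : ℂ) - z * (q : ℂ))).re = α * p + β * q := by
  rcases lt_trichotomy z.im 0 with h | h | h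
  · refine ⟨-Complex.I, 0, -z.im, le_rfl, by linarith, Or.inr (by linarith), fun p q => ?_⟩
    simp
  · refine ⟨1, 1, -z.re, zero_le_one, ?_, Or.inl one_ne_zero, fun p q => ?_⟩
    · by_contra hre
      push Not at hre
      refine hz (Real.sqrt z.re) (Real.sqrt_pos.2 (by linarith)) ?_
      rw [Real.sq_sqrt (by linarith)]
      exact Complex.ext (by simp) (by simpa using h)
    · simp [h]
      ring
  · refine ⟨Complex.I, 0, z.im, le_rfl, h.le, Or.inr h.ne', fun p q => ?_⟩
    simp

/-- The eigenvalues of the ladder operator are positive real numbers. -/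
theorem IsLadderEigenfunction.eq_zero_of_not_pos (h : IsLadderEigenfunction L μ z u f f')
    (hL : 0 < L) (hμ : 0 < μ) (hz : ∀ ω : ℝ, 0 < ω → z ≠ ((ω ^ 2 : ℝ) : ℂ)) : u = 0 := by
  obtain ⟨θ, α, β, hα, hβ, hne, hθ⟩ := exists_energy_direction hz
  have hcf : ∀ e, ContinuousOn (f e) (Icc (lo L e) (hi L e)) := fun e =>
    (h.helmholtz e).continuousOn (lo_lt_hi hL e).le
  have hcf' : ∀ e, ContinuousOn (f' e) (Icc (lo L e) (hi L e)) := fun e =>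
    (h.helmholtz e).continuousOn' (lo_lt_hi hL e).le
  let E : LadderEdge → ℝ := fun e => ∫ x in (lo L e)..(hi L e), (α * ‖f' e x‖ ^ 2 + β * ‖f e x‖ ^ 2)
  have hE0 : ∀ e, 0 ≤ E e := fun e =>
    intervalIntegral.integral_nonneg (lo_lt_hi hL e).le fun x _ => by positivity
  have hE : ∀ e, (θ * ((starRingEnd ℂ) (f e (hi L e)) * f' e (hi L e))).re
      - (θ * ((starRingEnd ℂ) (f e (lo L e)) * f' e (lo L e))).re = E e := by
    intro e
    have hle := (lo_lt_hi hL e).le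
    have h1 := (h.helmholtz e).energy hle
    rw [← Complex.sub_re, ← mul_sub, h1, ← intervalIntegral.integral_const_mul]
    have h2 : IntervalIntegrable (fun x => θ * ((((‖f' e x‖ ^ 2 : ℝ) : ℂ)
        - z * ((‖f e x‖ ^ 2 : ℝ) : ℂ)))) volume (lo L e) (hi L e) := by
      apply ContinuousOn.intervalIntegrable
      have := hcf e
      have := hcf' e
      rw [uIcc_of_le hle]
      fun_prop
    have h3 := intervalIntegral.intervalIntegral_re h2
    simp only [RCLike.re_to_complex] at h3
    rw [← h3]
    exact intervalIntegral.integral_congr fun x _ => hθ _ _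
  let G : LadderEdge → ℝ → ℝ := fun e x => (θ * ((starRingEnd ℂ) (f e x) * f' e x)).re
  -- P is the energy flux through the two rails. By continuity and Kirchhoff's conditions its
  -- increments are the weighted energies of the edges passed, so it is monotone; decay at both ends
  -- makes it zero, and every energy vanishes.
  let P : ℤ → ℝ := fun j => G (rail true j) j + G (rail false j) j
  have hP0 : Filter.Tendsto P Filter.cofinite (nhds 0) := by
    have hb : ∀ b, Filter.Tendsto (fun j : ℤ => G (rail b j) j) Filter.cofinite (nhds 0) := by
      intro b
      have h1 := (((Complex.continuous_conj.tendsto 0).comp (h.tendsto_rail b)).mul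
        (h.tendsto_deriv_rail b)).const_mul θ
      have h2 := (Complex.continuous_re.tendsto _).comp h1
      simp only [map_zero, mul_zero, Complex.zero_re] at h2
      exact h2
    simpa using (hb true).add (hb false)
  have hvert : ∀ j : ℤ, P j - (G (rail true (j - 1)) j + G (rail false (j - 1)) j)
      = weight μ (rung j) * E (rung j) := by
    intro j
    obtain ⟨⟨c1, c2⟩, c3, c4⟩ := h.cont j
    obtain ⟨k1, k2⟩ := h.kirchhoff j
    rw [← hE (rung j)]
    simp only [P, G, lo, hi]
    rw [← c1, ← c2, ← c3, ← c4]
    have hw : (weight μ (rail true j) : ℂ) = 1 ∧ (weight μ (rail true (j - 1)) : ℂ) = 1 ∧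
      (weight μ (rail false j) : ℂ) = 1 ∧ (weight μ (rail false (j - 1)) : ℂ) = 1 := by
      simp [weight]
    rw [hw.1, hw.2.1] at k1
    rw [hw.2.2.1, hw.2.2.2] at k2
    rw [← Complex.add_re, ← Complex.add_re, ← Complex.sub_re, ← Complex.sub_re,
      ← Complex.re_ofReal_mul]
    congr 1
    linear_combination θ * (starRingEnd ℂ) (f (rung j) (L / 2)) * k1
      + θ * (starRingEnd ℂ) (f (rung j) (-(L / 2))) * k2
  have hstep : ∀ j : ℤ, P (j + 1) - P j = E (rail true j) + E (rail false j)
      + weight μ (rung (j + 1)) * E (rung (j + 1)) := by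
    intro j
    have h1 := hvert (j + 1)
    have h2 := hE (rail true j)
    have h3 := hE (rail false j)
    rw [add_sub_cancel_right] at h1
    simp only [P, G, lo, hi] at h1 h2 h3 ⊢
    push_cast at h1 h2 h3 ⊢
    linarith
  have hw0 : ∀ j, 0 < weight μ (rung j) := fun j => by
    simp only [weight]
    split_ifs
    · exact hμ
    · exact one_pos
  have hmono : Monotone P := monotone_int_of_le_succ fun j => by
    have := hstep j
    have := mul_nonneg (hw0 (j + 1)).le (hE0 (rung (j + 1)))
    linarith [hE0 (rail true j), hE0 (rail false j)]
  rw [Int.cofinite_eq, Filter.tendsto_sup] at hP0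
  have hPz : ∀ j, P j = 0 := fun j =>
    le_antisymm (hmono.ge_of_tendsto hP0.2 j) (hmono.le_of_tendsto hP0.1 j)
  have hEz : ∀ e, E e = 0 := by
    have h1 : ∀ j : ℤ, E (rail true j) = 0 ∧ E (rail false j) = 0 ∧ E (rung (j + 1)) = 0 := by
      intro j
      have h2 := hstep j
      rw [hPz, hPz, sub_self] at h2
      have h3 := mul_nonneg (hw0 (j + 1)).le (hE0 (rung (j + 1)))
      have h4 := hE0 (rail true j)
      have h5 := hE0 (rail false j)
      refine ⟨by linarith, by linarith, ?_⟩
      have h6 : weight μ (rung (j + 1)) * E (rung (j + 1)) = 0 := by linarith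
      exact (mul_eq_zero.1 h6).resolve_left (hw0 _).ne'
    rintro (j | ⟨b, j⟩)
    · simpa using (h1 (j - 1)).2.2
    · cases b
      · exact (h1 j).2.1
      · exact (h1 j).1
  have hpt : ∀ e, ∀ x ∈ Icc (lo L e) (hi L e), α * ‖f' e x‖ ^ 2 + β * ‖f e x‖ ^ 2 = 0 := fun e =>
    eqOn_zero_of_integral_eq_zero (lo_lt_hi hL e) hα hβ (hcf e) (hcf' e) (hEz e)
  rcases hne with hα' | hβ'
  -- Here only f' is known to vanish: f is constant on each edge, hence along each side of the
  -- ladder, and decay makes the constant zero.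
  · have hd : ∀ e, ∀ x ∈ Icc (lo L e) (hi L e), f' e x = 0 := by
      intro e x hx
      have h1 := hpt e x hx
      have h2 : 0 ≤ β * ‖f e x‖ ^ 2 := by positivity
      have h3 : 0 ≤ α * ‖f' e x‖ ^ 2 := by positivity
      have h4 : α * ‖f' e x‖ ^ 2 = 0 := by linarith
      simpa [hα'] using h4
    have hconst : ∀ e, ∀ x ∈ Icc (lo L e) (hi L e), f e x = f e (lo L e) := fun e =>
      eq_left_of_hasDerivAt_zero (hcf e) fun x hx => by
        have := (h.helmholtz e).hasDerivAt hx
        rwa [hd e x (Ioo_subset_Icc_self hx)] at this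
    have hside : ∀ b, (∀ j : ℤ, f (rail b (j + 1)) ((j + 1 : ℤ) : ℝ)
        = f (rail b j) ((j + 1 : ℤ) : ℝ)) → ∀ j : ℤ, f (rail b j) j = 0 := by
      intro b hj j
      have hsucc : ∀ j : ℤ, f (rail b (j + 1)) ((j + 1 : ℤ) : ℝ) = f (rail b j) j := fun j => by
        rw [hj j]
        exact hconst (rail b j) _ (by simp [lo, hi])
      have h1 := eq_zero_of_tendsto_of_norm_le_succ
        (a := fun n : ℕ => f (rail b (j + n)) ((j + n : ℤ) : ℝ)) (by
          rw [← Nat.cofinite_eq_atTop]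
          exact (h.tendsto_rail b).comp
            (Function.Injective.tendsto_cofinite fun m n hmn => by simpa using hmn))
        (fun n => by
          rw [← hsucc (j + n)]
          exact le_of_eq (by push_cast; ring_nf)) 0
      simpa using h1
    have ht := hside true fun j => by
      have := h.cont (j + 1)
      rw [add_sub_cancel_right] at this
      rw [← this.1.1, this.1.2]
    have hf := hside false fun j => by
      have := h.cont (j + 1)
      rw [add_sub_cancel_right] at this
      rw [← this.2.1, this.2.2]
    refine h.eq_zero_of_edges (fun b j x hx => ?_) fun j y hy => ?_
    · rw [hconst (rail b j) x hx]
      cases b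
      · exact hf j
      · exact ht j
    · rw [hconst (rung j) y hy]
      exact ((h.cont j).2.1).trans (hf j)
  · refine h.rep.eq_zero fun e x hx => ?_
    have h1 := hpt e x hx
    have h2 : 0 ≤ β * ‖f e x‖ ^ 2 := by positivity
    have h3 : 0 ≤ α * ‖f' e x‖ ^ 2 := by positivity
    have h4 : β * ‖f e x‖ ^ 2 = 0 := by linarith
    simpa [hβ'] using h4

end Positivity

/-! ### No discrete spectrum for μ ≥ 1. -/

/-- With κ = 1 + d the equation is (c − s)² = 1 + d²s². The inequality then requires cs > (1 + d)s²,
whereas c² + t² = 1 turns the equation into s² − 2cs = t² + d²s² ≥ 0, that is cs ≤ s²/2. -/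
theorem dispersion_impossible {c s κ t : ℝ} (hc : c ^ 2 + t ^ 2 = 1) (hκ : |c - κ * s| < 1)
    (hμ : 1 ≤ κ)
    (h : (c - κ * s) ^ 2 - 2 * (c - s) * (c - κ * s) + 1 = 0) : False := by
  have h1 : (c - κ * s) ^ 2 < 1 := by
    rw [← sq_abs]
    nlinarith [abs_nonneg (c - κ * s)]
  obtain ⟨d, hd, rfl⟩ : ∃ d : ℝ, 0 ≤ d ∧ κ = 1 + d := ⟨κ - 1, by linarith, by ring⟩
  have h2 : (c - s) ^ 2 = 1 + d ^ 2 * s ^ 2 := by linear_combination -h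
  have h3 : 0 < d * (c * s - s ^ 2 - d * s ^ 2) := by nlinarith
  have h4 : 0 < c * s - s ^ 2 - d * s ^ 2 := pos_of_mul_pos_right h3 hd
  have h5 : s ^ 2 - 2 * (c * s) = t ^ 2 + d ^ 2 * s ^ 2 := by linear_combination h2 - hc
  nlinarith [sq_nonneg t, sq_nonneg (d * s), sq_nonneg s, mul_nonneg hd (sq_nonneg s)]

/-- Eigenvalues can occur only at common zeros of sin ω and cos(ωL/2), where infinite multiplicity
keeps them out of the discrete spectrum. -/
theorem discreteSpectrum_eq_empty {L μ : ℝ} (hL : 0 < L) (hμ : 1 ≤ μ) :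
    discreteSpectrum (ladderSymOp L μ) = ∅ := by
  have hμ0 : 0 < μ := by linarith
  refine eq_empty_of_forall_notMem fun z hz => ?_
  obtain ⟨-, -, hp, hfin⟩ := hz
  by_cases hpos : ∃ ω : ℝ, 0 < ω ∧ z = ((ω ^ 2 : ℝ) : ℂ)
  swap
  · push Not at hpos
    exact notMem_pointSpectrum_of_forall hL hμ0
      (fun u f f' _ h => h.eq_zero_of_not_pos hL hμ0 hpos) hp
  obtain ⟨ω, hω, rfl⟩ := hpos
  by_cases hs : Real.sin ω = 0 <;> by_cases hC : Real.cos (ω * L / 2) = 0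
  · exact not_finiteDimensional_eigenspace hL hμ0 hω.ne' hs hC hfin
  · exact notMem_pointSpectrum_of_sin_eq_zero hL hμ0 hω.ne' hs hC hp
  · exact notMem_pointSpectrum_of_cos_eq_zero hL hμ0 hω.ne' hs hC hp
  · obtain ⟨h1, h2⟩ := dispersion_of_mem_pointSpectrum hL hμ0 hω.ne' hs hC hp
    set s := Real.sin ω * Real.tan (ω * L / 2) / 2 with hsdef
    have e1 : ∀ w, vertexCoeff L w ω = Real.cos ω - w * s := fun w => by
      rw [vertexCoeff, hsdef]; ring
    rw [e1] at h1
    rw [e1, e1, one_mul] at h2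
    exact dispersion_impossible (Real.cos_sq_add_sin_sq ω) h1 hμ h2

/-! ### Zeros of the gap function. -/

/-- The function whose zeros in a gap are the square roots of the eigenvalues, for
`a = 1 - (1 - μ)²`; for `a = 1` its zeros are the ends of the gaps. -/
def gapFun (L a ω : ℝ) : ℝ :=
  4 * Real.cos (ω * L / 2) ^ 2 * Real.sin ω
    + 4 * (Real.sin (ω * L / 2) * Real.cos (ω * L / 2)) * Real.cos ω
    - a * Real.sin ω * Real.sin (ω * L / 2) ^ 2

theorem gapFun_neg (L a ω : ℝ) : gapFun L a (-ω) = -gapFun L a ω := by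
  have h : -ω * L / 2 = -(ω * L / 2) := by ring
  simp only [gapFun, h, Real.sin_neg, Real.cos_neg]
  ring

theorem gapFun_eq_add (L a ω : ℝ) : gapFun L a ω
    = gapFun L 1 ω + (1 - a) * Real.sin ω * Real.sin (ω * L / 2) ^ 2 := by
  simp only [gapFun]
  ring

theorem continuous_sin_mul_gapFun (L a : ℝ) : Continuous fun ω => Real.sin ω * gapFun L a ω := by
  unfold gapFun
  fun_prop

/-- The cotangent of `κ x` is strictly decreasing between its poles. -/
theorem cot_mul_lt {κ x y : ℝ} (hκ : 0 < κ) (hxy : x < y)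
    (h : ∀ w ∈ Icc x y, Real.sin (κ * w) ≠ 0) :
    Real.cos (κ * y) / Real.sin (κ * y) < Real.cos (κ * x) / Real.sin (κ * x) := by
  have hd : ∀ w ∈ Icc x y, HasDerivAt (fun w => Real.cos (κ * w) / Real.sin (κ * w))
      (-(κ / Real.sin (κ * w) ^ 2)) w := by
    intro w hw
    have hlin : HasDerivAt (fun w : ℝ => κ * w) κ w := by
      simpa using (hasDerivAt_id w).const_mul κ
    refine (hlin.cos.div hlin.sin (h w hw)).congr_deriv ?_
    have := h w hw
    field_simp
    linear_combination -Real.sin_sq_add_cos_sq (κ * w)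
  have hanti : StrictAntiOn (fun w => Real.cos (κ * w) / Real.sin (κ * w)) (Icc x y) := by
    refine strictAntiOn_of_deriv_neg (convex_Icc x y)
      (fun w hw => (hd w hw).continuousAt.continuousWithinAt) fun w hw => ?_
    rw [interior_Icc] at hw
    rw [(hd w (Ioo_subset_Icc_self hw)).deriv]
    have := h w (Ioo_subset_Icc_self hw)
    have : 0 < κ / Real.sin (κ * w) ^ 2 := by positivity
    linarith
  exact hanti ⟨le_rfl, hxy.le⟩ ⟨hxy.le, le_rfl⟩ hxy

/-- Valid at s = 0 too, because c/0 = 0. It lets the sign of sin · cos stand for the sign of the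
cotangent. -/
theorem mul_div_sq_eq (s c : ℝ) : s * c = s ^ 2 * (c / s) := by
  rcases eq_or_ne s 0 with rfl | h
  · simp
  · field_simp

section Gap

variable {L a b t : ℝ}

/-- Where sin(ωL/2) = 0 the product is 4 cos²(ωL/2) sin²ω ≥ 0. Hence neither cotangent has a pole
inside a gap. -/
theorem sin_ne_zero_of_gap {ω : ℝ} (h : Real.sin ω * gapFun L 1 ω < 0) :
    Real.sin ω ≠ 0 ∧ Real.sin (ω * L / 2) ≠ 0 := by
  constructor
  · intro h0
    rw [h0, zero_mul] at h
    exact lt_irrefl _ h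
  · intro h0
    simp only [gapFun, h0] at h
    nlinarith [sq_nonneg (Real.cos (ω * L / 2) * Real.sin ω)]

/-- `cot (ω L / 2)` decreases strictly, expressed through the sign of `sin · cos`. -/
theorem sin_mul_cos_neg_of_nonpos (hL : 0 < L) {x y : ℝ} (hxy : x < y)
    (h : ∀ w ∈ Icc x y, Real.sin (w * L / 2) ≠ 0)
    (hx : Real.sin (x * L / 2) * Real.cos (x * L / 2) ≤ 0) :
    Real.sin (y * L / 2) * Real.cos (y * L / 2) < 0 := by
  have e : ∀ w, w * L / 2 = L / 2 * w := fun w => by ring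
  simp only [e] at h hx ⊢
  have hlt := cot_mul_lt (by linarith : 0 < L / 2) hxy h
  have hsx := h x ⟨le_rfl, hxy.le⟩
  have hsy := h y ⟨hxy.le, le_rfl⟩
  rw [mul_div_sq_eq] at hx ⊢
  have h1 : Real.cos (L / 2 * x) / Real.sin (L / 2 * x) ≤ 0 :=
    nonpos_of_mul_nonpos_right hx (by positivity)
  exact mul_neg_of_pos_of_neg (by positivity) (hlt.trans_le h1)

theorem sin_mul_cos_pos_of_nonneg (hL : 0 < L) {x y : ℝ} (hxy : x < y)
    (h : ∀ w ∈ Icc x y, Real.sin (w * L / 2) ≠ 0)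
    (hy : 0 ≤ Real.sin (y * L / 2) * Real.cos (y * L / 2)) :
    0 < Real.sin (x * L / 2) * Real.cos (x * L / 2) := by
  by_contra hx
  push Not at hx
  exact absurd hy (not_le.2 (sin_mul_cos_neg_of_nonpos hL hxy h hx))

/-- On each side of the zero of `cot (ω L / 2)` there is at most one zero of `gapFun`. -/
theorem gapFun_zero_unique_aux (hL : 0 < L) (ha : 0 < a) {x y : ℝ} (hxy : x < y)
    (hgap : ∀ w ∈ Icc x y, Real.sin w * gapFun L 1 w < 0)
    (hx : gapFun L a x = 0) (hy : gapFun L a y = 0)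
    (hsign : 0 < (Real.sin (x * L / 2) * Real.cos (x * L / 2))
      * (Real.sin (y * L / 2) * Real.cos (y * L / 2))) : False := by
  have hS : ∀ w ∈ Icc x y, Real.sin (w * L / 2) ≠ 0 := fun w hw => (sin_ne_zero_of_gap (hgap w hw)).2
  have hs : ∀ w ∈ Icc x y, Real.sin w ≠ 0 := fun w hw => (sin_ne_zero_of_gap (hgap w hw)).1
  have e : ∀ w, w * L / 2 = L / 2 * w := fun w => by ring
  have hlt := cot_mul_lt (by linarith : 0 < L / 2) hxy (by simpa only [e] using hS)
  have hlt' := cot_mul_lt one_pos hxy (by simpa only [one_mul] using hs)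
  have hx0 : x ∈ Icc x y := ⟨le_rfl, hxy.le⟩
  have hy0 : y ∈ Icc x y := ⟨hxy.le, le_rfl⟩
  simp only [one_mul, ← e] at hlt hlt'
  have key : ∀ w ∈ Icc x y, gapFun L a w = 0 →
      4 * (Real.cos (w * L / 2) / Real.sin (w * L / 2)) ^ 2
        + 4 * (Real.cos (w * L / 2) / Real.sin (w * L / 2)) * (Real.cos w / Real.sin w) = a := by
    intro w hw h0
    have h1 := hS w hw
    have h2 := hs w hw
    rw [gapFun] at h0
    field_simp
    linear_combination h0
  have kx := key x hx0 hx
  have ky := key y hy0 hy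
  rw [mul_div_sq_eq (Real.sin (x * L / 2)) (Real.cos (x * L / 2)),
    mul_div_sq_eq (Real.sin (y * L / 2)) (Real.cos (y * L / 2))] at hsign
  have h1 := hS x hx0
  have h2 := hS y hy0
  set φ := Real.cos (x * L / 2) / Real.sin (x * L / 2)
  set ψ := Real.cos (y * L / 2) / Real.sin (y * L / 2)
  set σ := Real.cos x / Real.sin x
  set τ := Real.cos y / Real.sin y
  have hpos : 0 < φ * ψ := by
    have : 0 < (Real.sin (x * L / 2) ^ 2 * Real.sin (y * L / 2) ^ 2) * (φ * ψ) := by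
      nlinarith
    exact pos_of_mul_pos_right this (by positivity)
  -- At a zero 4(φ + σ) = a/φ, with a decreasing left side and an increasing right side. Subtracting
  -- the equations at x and y and clearing denominators gives a vanishing sum of two positive terms.
  have h3 : 4 * (φ * ψ) * (σ - τ) + (φ - ψ) * (a + 4 * (φ * ψ)) = 0 := by
    linear_combination ψ * kx - φ * ky
  have h4 : 0 < 4 * (φ * ψ) * (σ - τ) := by
    have := sub_pos.2 hlt'
    positivity
  have h5 : 0 < (φ - ψ) * (a + 4 * (φ * ψ)) := by
    have := sub_pos.2 hlt
    positivity
  linarith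

theorem gapFun_zero_unique (hL : 0 < L) (ha : 0 < a)
    (hgap : ∀ w ∈ Ioo b t, Real.sin w * gapFun L 1 w < 0) {x y : ℝ} (hxI : x ∈ Ioo b t)
    (hyI : y ∈ Ioo b t) (hx : gapFun L a x = 0) (hy : gapFun L a y = 0)
    (hsign : 0 < (Real.sin (x * L / 2) * Real.cos (x * L / 2))
      * (Real.sin (y * L / 2) * Real.cos (y * L / 2))) : x = y := by
  have hsub : ∀ x ∈ Ioo b t, ∀ y ∈ Ioo b t, ∀ w ∈ Icc x y, Real.sin w * gapFun L 1 w < 0 :=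
    fun x hx y hy w hw => hgap w ⟨hx.1.trans_le hw.1, hw.2.trans_lt hy.2⟩
  rcases lt_trichotomy x y with h | h | h
  · exact (gapFun_zero_unique_aux hL ha h (hsub x hxI y hyI) hx hy hsign).elim
  · exact h
  · exact (gapFun_zero_unique_aux hL ha h (hsub y hyI x hxI) hy hx (by linarith)).elim

theorem cos_ne_zero_of_gapFun_eq_zero {ω : ℝ} (ha : 0 < a) (hs : Real.sin ω ≠ 0)
    (h0 : gapFun L a ω = 0) : Real.cos (ω * L / 2) ≠ 0 := by
  intro hC
  have h1 := Real.sin_sq_add_cos_sq (ω * L / 2)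
  simp only [gapFun, hC] at h0 h1
  have : a * Real.sin ω = 0 := by linear_combination -h0 + (-a * Real.sin ω) * h1
  exact mul_ne_zero ha.ne' hs this

/-- At such a point only the excess (1 − a) sin²ω sin²(ωL/2) remains, so a < 1 makes the sign
opposite to the one of `gapFun L 1` inside the gap. -/
theorem sin_mul_gapFun_pos {ω : ℝ} (ha1 : a < 1) (hs : Real.sin ω ≠ 0)
    (hS : Real.sin (ω * L / 2) ≠ 0) (h0 : gapFun L 1 ω = 0) :
    0 < Real.sin ω * gapFun L a ω := by
  rw [gapFun_eq_add, h0]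
  have h1 : 0 < 1 - a := by linarith
  have : 0 < (1 - a) * (Real.sin ω ^ 2 * Real.sin (ω * L / 2) ^ 2) := by positivity
  linarith

/-- A gap whose ends lie on both branches contains exactly two zeros. -/
theorem gapFun_zeros_of_two_branches (hL : 0 < L) (ha : 0 < a) (ha1 : a < 1) (hbt : b < t)
    (hgap : ∀ w ∈ Ioo b t, Real.sin w * gapFun L 1 w < 0)
    (hsb : Real.sin b ≠ 0) (hst : Real.sin t ≠ 0)
    (hb : 0 < Real.sin (b * L / 2) * Real.cos (b * L / 2)) (hb0 : gapFun L 1 b = 0)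
    (ht : Real.sin (t * L / 2) * Real.cos (t * L / 2) < 0) (ht0 : gapFun L 1 t = 0) :
    ∃ x y, b < x ∧ x < y ∧ y < t ∧ ∀ w ∈ Ioo b t, gapFun L a w = 0 ↔ w = x ∨ w = y := by
  have hSb : Real.sin (b * L / 2) ≠ 0 := fun h => by rw [h, zero_mul] at hb; exact lt_irrefl _ hb
  have hSt : Real.sin (t * L / 2) ≠ 0 := fun h => by rw [h, zero_mul] at ht; exact lt_irrefl _ ht
  have hS : ∀ w ∈ Icc b t, Real.sin (w * L / 2) ≠ 0 := by
    intro w hw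
    rcases hw.1.eq_or_lt with rfl | h1
    · exact hSb
    rcases hw.2.eq_or_lt with rfl | h2
    · exact hSt
    exact (sin_ne_zero_of_gap (hgap w ⟨h1, h2⟩)).2
  -- The cotangent of ωL/2 changes sign at m, where the product is −a sin²m sin²(mL/2) < 0; one zero
  -- lies on each side.
  obtain ⟨m, hm, hm0⟩ : ∃ m ∈ Ioo b t, Real.sin (m * L / 2) * Real.cos (m * L / 2) = 0 :=
    intermediate_value_Ioo' hbt.le
      (f := fun w => Real.sin (w * L / 2) * Real.cos (w * L / 2)) (by fun_prop) ⟨ht, hb⟩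
  have hCm : Real.cos (m * L / 2) = 0 := (mul_eq_zero.1 hm0).resolve_left (hS m ⟨hm.1.le, hm.2.le⟩)
  have hKm : Real.sin m * gapFun L a m < 0 := by
    have h1 := hS m ⟨hm.1.le, hm.2.le⟩
    have h2 := (sin_ne_zero_of_gap (hgap m hm)).1
    have h3 : Real.sin m * gapFun L a m
        = -(a * (Real.sin m ^ 2 * Real.sin (m * L / 2) ^ 2)) := by
      simp only [gapFun, hCm]
      ring
    have : 0 < a * (Real.sin m ^ 2 * Real.sin (m * L / 2) ^ 2) := by positivity
    linarith
  have hKb := sin_mul_gapFun_pos ha1 hsb hSb hb0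
  have hKt := sin_mul_gapFun_pos ha1 hst hSt ht0
  have hK := continuous_sin_mul_gapFun L a
  obtain ⟨x, hx, hx0⟩ : ∃ x ∈ Ioo b m, Real.sin x * gapFun L a x = 0 :=
    intermediate_value_Ioo' hm.1.le hK.continuousOn ⟨hKm, hKb⟩
  obtain ⟨y, hy, hy0⟩ : ∃ y ∈ Ioo m t, Real.sin y * gapFun L a y = 0 :=
    intermediate_value_Ioo hm.2.le hK.continuousOn ⟨hKm, hKt⟩
  have hxI : x ∈ Ioo b t := ⟨hx.1, hx.2.trans hm.2⟩
  have hyI : y ∈ Ioo b t := ⟨hm.1.trans hy.1, hy.2⟩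
  have hx0' := (mul_eq_zero.1 hx0).resolve_left (sin_ne_zero_of_gap (hgap x hxI)).1
  have hy0' := (mul_eq_zero.1 hy0).resolve_left (sin_ne_zero_of_gap (hgap y hyI)).1
  have hleft : ∀ w ∈ Ioo b m, 0 < Real.sin (w * L / 2) * Real.cos (w * L / 2) := fun w hw =>
    sin_mul_cos_pos_of_nonneg hL hw.2
      (fun v hv => hS v ⟨hw.1.le.trans hv.1, hv.2.trans hm.2.le⟩) hm0.ge
  have hright : ∀ w ∈ Ioo m t, Real.sin (w * L / 2) * Real.cos (w * L / 2) < 0 := fun w hw =>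
    sin_mul_cos_neg_of_nonpos hL hw.1
      (fun v hv => hS v ⟨hm.1.le.trans hv.1, hv.2.trans hw.2.le⟩) hm0.le
  refine ⟨x, y, hx.1, hx.2.trans hy.1, hy.2, fun w hw => ⟨fun h0 => ?_, ?_⟩⟩
  · rcases lt_trichotomy w m with h | rfl | h
    · exact Or.inl (gapFun_zero_unique hL ha hgap hw hxI h0 hx0'
        (mul_pos (hleft w ⟨hw.1, h⟩) (hleft x hx)))
    · exact absurd hCm (cos_ne_zero_of_gapFun_eq_zero ha (sin_ne_zero_of_gap (hgap w hw)).1 h0)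
    · exact Or.inr (gapFun_zero_unique hL ha hgap hw hyI h0 hy0'
        (mul_pos_of_neg_of_neg (hright w ⟨h, hw.2⟩) (hright y hy)))
  · rintro (rfl | rfl)
    · exact hx0'
    · exact hy0'

/-- At a multiple b of π the product vanishes and gives no sign. Splitting off sin(ω − b) leaves a
factor whose sign near b can be read off; cos b = ±1 enters only squared. -/
theorem sin_mul_gapFun_of_sin_eq_zero (hsb : Real.sin b = 0) (ω : ℝ) :
    Real.sin ω * gapFun L a ω = Real.sin (ω - b) * (Real.sin (ω - b) *
      (4 * Real.cos (ω * L / 2) ^ 2 - a * Real.sin (ω * L / 2) ^ 2)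
      + 4 * (Real.sin (ω * L / 2) * Real.cos (ω * L / 2)) * Real.cos (ω - b)) := by
  have hcb : Real.cos b ^ 2 = 1 := by
    have := Real.sin_sq_add_cos_sq b
    rw [hsb] at this
    linarith
  rw [gapFun, Real.sin_sub, Real.cos_sub, hsb]
  linear_combination (-(Real.sin ω * (Real.sin ω *
      (4 * Real.cos (ω * L / 2) ^ 2 - a * Real.sin (ω * L / 2) ^ 2)
      + 4 * (Real.sin (ω * L / 2) * Real.cos (ω * L / 2)) * Real.cos ω))) * hcb

/-- A gap that starts at a multiple of `π` contains exactly one zero. -/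
theorem gapFun_zero_of_left_degenerate (hL : 0 < L) (ha : 0 < a) (ha1 : a < 1) (hbt : b < t)
    (hgap : ∀ w ∈ Ioo b t, Real.sin w * gapFun L 1 w < 0)
    (hsb : Real.sin b = 0) (hst : Real.sin t ≠ 0)
    (hb : Real.sin (b * L / 2) * Real.cos (b * L / 2) ≤ 0)
    (ht : Real.sin (t * L / 2) * Real.cos (t * L / 2) < 0) (ht0 : gapFun L 1 t = 0) :
    ∃ x, b < x ∧ x < t ∧ ∀ w ∈ Ioo b t, gapFun L a w = 0 ↔ w = x := by
  have hev : ∀ {δ : ℝ}, 0 < δ → ∀ᶠ w in nhdsWithin b (Ioi b), w ∈ Ioo b (b + δ) := fun hδ =>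
    Ioo_mem_nhdsGT (by linarith)
  have hnear : ∀ {F : ℝ → ℝ} {c : ℝ}, Continuous F → F b < c →
      ∀ᶠ w in nhdsWithin b (Ioi b), F w < c := fun hF h =>
    (hF.continuousAt.eventually_lt_const h).filter_mono nhdsWithin_le_nhds
  have hsinpos : ∀ᶠ w in nhdsWithin b (Ioi b), 0 < Real.sin (w - b) := by
    filter_upwards [hev Real.pi_pos] with w hw
    exact Real.sin_pos_of_pos_of_lt_pi (by linarith [hw.1]) (by linarith [hw.2])
  have hcospos : ∀ᶠ w in nhdsWithin b (Ioi b), 0 < Real.cos (w - b) := by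
    filter_upwards [hev Real.pi_div_two_pos] with w hw
    exact Real.cos_pos_of_mem_Ioo ⟨by linarith [hw.1, Real.pi_pos], by linarith [hw.2]⟩
  -- A pole of the cotangent at b also satisfies `hb`, since sin · cos is zero there. It is excluded
  -- because just to its right cot(ωL/2) is large and positive, which contradicts the gap
  -- inequality.
  have hSb : Real.sin (b * L / 2) ≠ 0 := by
    intro hSb
    have hCb : Real.cos (b * L / 2) ^ 2 = 1 := by
      have := Real.sin_sq_add_cos_sq (b * L / 2)
      rw [hSb] at this
      linarith
    have h1 : ∀ᶠ w in nhdsWithin b (Ioi b),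
        Real.sin (w * L / 2) ^ 2 - 4 * Real.cos (w * L / 2) ^ 2 < 0 :=
      hnear (by fun_prop) (by rw [hSb, hCb]; norm_num)
    have h2 : ∀ᶠ w in nhdsWithin b (Ioi b),
        0 < Real.sin (w * L / 2) * Real.cos (w * L / 2) := by
      filter_upwards [hev (div_pos Real.pi_pos hL)] with w hw
      have e1 : w * L / 2 = (w - b) * L / 2 + b * L / 2 := by ring
      have h3 : Real.sin (w * L / 2) * Real.cos (w * L / 2)
          = Real.sin ((w - b) * L / 2) * Real.cos ((w - b) * L / 2) := by
        rw [e1, Real.sin_add, Real.cos_add, hSb]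
        linear_combination (Real.sin ((w - b) * L / 2) * Real.cos ((w - b) * L / 2)) * hCb
      have h4 : 0 < (w - b) * L / 2 := by
        have := mul_pos (sub_pos.2 hw.1) hL
        linarith
      have h5 : (w - b) * L / 2 < Real.pi / 2 := by
        have h6 : w - b < Real.pi / L := by linarith [hw.2]
        rw [lt_div_iff₀ hL] at h6
        linarith
      rw [h3]
      exact mul_pos (Real.sin_pos_of_pos_of_lt_pi h4 (by linarith [Real.pi_pos]))
        (Real.cos_pos_of_mem_Ioo ⟨by linarith [Real.pi_pos], h5⟩)
    obtain ⟨w, hw, k1, k2, k3, k4⟩ :=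
      ((hev (sub_pos.2 hbt)).and (hsinpos.and (hcospos.and (h1.and h2)))).exists
    have h6 := hgap w ⟨hw.1, by linarith [hw.2]⟩
    rw [sin_mul_gapFun_of_sin_eq_zero hsb] at h6
    have h7 : 0 < Real.sin (w - b) *
      (4 * Real.cos (w * L / 2) ^ 2 - 1 * Real.sin (w * L / 2) ^ 2) :=
      mul_pos k1 (by linarith)
    have h8 := mul_pos k4 k2
    have h9 := mul_pos k1 (add_pos h7 (by linarith : 0 < 4 * (Real.sin (w * L / 2) *
      Real.cos (w * L / 2)) * Real.cos (w - b)))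
    linarith
  have hSt : Real.sin (t * L / 2) ≠ 0 := fun h => by rw [h, zero_mul] at ht; exact lt_irrefl _ ht
  have hS : ∀ w ∈ Icc b t, Real.sin (w * L / 2) ≠ 0 := by
    intro w hw
    rcases hw.1.eq_or_lt with rfl | h1
    · exact hSb
    rcases hw.2.eq_or_lt with rfl | h2
    · exact hSt
    exact (sin_ne_zero_of_gap (hgap w ⟨h1, h2⟩)).2
  have hneg : ∀ w ∈ Ioo b t, Real.sin (w * L / 2) * Real.cos (w * L / 2) < 0 := fun w hw =>
    sin_mul_cos_neg_of_nonpos hL hw.1 (fun v hv => hS v ⟨hv.1, hv.2.trans hw.2.le⟩) hb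
  obtain ⟨m, hm, hKm⟩ : ∃ m ∈ Ioo b t, Real.sin m * gapFun L a m < 0 := by
    have hM : ∀ᶠ w in nhdsWithin b (Ioi b), Real.sin (w - b) *
        (4 * Real.cos (w * L / 2) ^ 2 - a * Real.sin (w * L / 2) ^ 2)
        + 4 * (Real.sin (w * L / 2) * Real.cos (w * L / 2)) * Real.cos (w - b) < 0 := by
      -- If sin · cos is negative at b, the last term decides by continuity. If it is zero then
      -- cos(bL/2) = 0, and both terms are negative to the right of b.
      rcases hb.lt_or_eq with hb | hb
      · exact hnear (by fun_prop) (by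
          rw [sub_self, Real.sin_zero, Real.cos_zero]
          linarith)
      · have hCb := (mul_eq_zero.1 hb).resolve_left hSb
        have h1 : ∀ᶠ w in nhdsWithin b (Ioi b),
            4 * Real.cos (w * L / 2) ^ 2 - a * Real.sin (w * L / 2) ^ 2 < 0 := by
          refine hnear (by fun_prop) ?_
          rw [hCb]
          have : 0 < a * Real.sin (b * L / 2) ^ 2 := by positivity
          linarith
        filter_upwards [h1, hev (sub_pos.2 hbt), hsinpos, hcospos] with w k1 k2 k3 k4
        have k5 := mul_neg_of_pos_of_neg k3 k1
        have k6 := mul_neg_of_neg_of_pos (hneg w ⟨k2.1, by linarith [k2.2]⟩) k4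
        linarith
    obtain ⟨m, k1, k2, k3⟩ := (hM.and ((hev (sub_pos.2 hbt)).and hsinpos)).exists
    refine ⟨m, ⟨k2.1, by linarith [k2.2]⟩, ?_⟩
    rw [sin_mul_gapFun_of_sin_eq_zero hsb]
    exact mul_neg_of_pos_of_neg k3 k1
  obtain ⟨x, hx, hx0⟩ : ∃ x ∈ Ioo m t, Real.sin x * gapFun L a x = 0 :=
    intermediate_value_Ioo hm.2.le (continuous_sin_mul_gapFun L a).continuousOn
      ⟨hKm, sin_mul_gapFun_pos ha1 hst hSt ht0⟩
  have hxI : x ∈ Ioo b t := ⟨hm.1.trans hx.1, hx.2⟩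
  have hx0' := (mul_eq_zero.1 hx0).resolve_left (sin_ne_zero_of_gap (hgap x hxI)).1
  refine ⟨x, hxI.1, hxI.2, fun w hw => ⟨fun h0 => ?_, fun h => h ▸ hx0'⟩⟩
  exact gapFun_zero_unique hL ha hgap hw hxI h0 hx0'
    (mul_pos_of_neg_of_neg (hneg w hw) (hneg x hxI))

/-- A gap that ends at a multiple of `π` contains exactly one zero. -/
theorem gapFun_zero_of_right_degenerate (hL : 0 < L) (ha : 0 < a) (ha1 : a < 1) (hbt : b < t)
    (hgap : ∀ w ∈ Ioo b t, Real.sin w * gapFun L 1 w < 0)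
    (hsb : Real.sin b ≠ 0) (hst : Real.sin t = 0)
    (hb : 0 < Real.sin (b * L / 2) * Real.cos (b * L / 2)) (hb0 : gapFun L 1 b = 0)
    (ht : 0 ≤ Real.sin (t * L / 2) * Real.cos (t * L / 2)) :
    ∃ x, b < x ∧ x < t ∧ ∀ w ∈ Ioo b t, gapFun L a w = 0 ↔ w = x := by
  have e : ∀ w, -w * L / 2 = -(w * L / 2) := fun w => by ring
  -- The reflection ω ↦ −ω exchanges the ends and, `gapFun` being odd, preserves the gap inequality.
  obtain ⟨x, h1, h2, h3⟩ := gapFun_zero_of_left_degenerate (b := -t) (t := -b) hL ha ha1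
    (by linarith) (fun w hw => by
      have := hgap (-w) ⟨by linarith [hw.2], by linarith [hw.1]⟩
      rwa [gapFun_neg, Real.sin_neg, neg_mul_neg] at this)
    (by rw [Real.sin_neg, hst, neg_zero]) (by rwa [Real.sin_neg, neg_ne_zero])
    (by rw [e, Real.sin_neg, Real.cos_neg]; linarith)
    (by rw [e, Real.sin_neg, Real.cos_neg]; linarith)
    (by rw [gapFun_neg, hb0, neg_zero])
  refine ⟨-x, by linarith, by linarith, fun w hw => ?_⟩
  have := h3 (-w) ⟨by linarith [hw.2], by linarith [hw.1]⟩
  rw [gapFun_neg, neg_eq_zero] at this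
  rw [this]
  exact neg_eq_iff_eq_neg

end Gap

/-! ### From spectral data to the gap function. -/

section Bridge

variable {L μ ω : ℝ}

theorem vertexCoeff_eq (L w ω : ℝ) : vertexCoeff L w ω
    = Real.cos ω - w * (Real.sin ω * (Real.sin (ω * L / 2) / Real.cos (ω * L / 2)) / 2) := by
  rw [vertexCoeff, Real.tan_eq_sin_div_cos]
  ring

/-- Points outside the essential spectrum satisfy the gap inequality. -/
theorem sin_mul_gapFun_neg_of_notMem (hL : 0 < L) (hμ : 0 < μ) (hω : ω ≠ 0)
    (hs : Real.sin ω ≠ 0)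
    (h : ((ω ^ 2 : ℝ) : ℂ) ∉ essentialSpectrum (ladderSymOp L μ)) :
    Real.sin ω * gapFun L 1 ω < 0 := by
  by_cases hC : Real.cos (ω * L / 2) = 0
  · have h1 := Real.sin_sq_add_cos_sq (ω * L / 2)
    have : 0 < Real.sin ω ^ 2 := by positivity
    rw [gapFun, hC]
    rw [hC] at h1
    have h2 : Real.sin (ω * L / 2) ^ 2 = 1 := by linarith
    rw [h2]
    linarith
  · have hg : 1 < |vertexCoeff L 1 ω| := by
      by_contra hg
      exact h (mem_essentialSpectrum_of_band hL hμ hω hs hC (not_lt.1 hg))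
    have h1 : 1 < vertexCoeff L 1 ω ^ 2 := (one_lt_sq_iff_one_lt_abs _).2 hg
    -- The factor 1 − g_1² is negative exactly outside the bands.
    have h2 : Real.sin ω * gapFun L 1 ω
        = 4 * Real.cos (ω * L / 2) ^ 2 * (1 - vertexCoeff L 1 ω ^ 2) := by
      rw [vertexCoeff_eq, gapFun]
      field_simp
      linear_combination (16 * Real.cos (ω * L / 2) ^ 2) * Real.sin_sq_add_cos_sq ω
    rw [h2]
    exact mul_neg_of_pos_of_neg (by positivity) (by linarith)

/-- The equation gives 1 − (c − κs)² = (1 − κ)(κ²s² + t²) > 0, so decay is automatic for a weight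
below one. -/
theorem dispersion_holds {c s κ t : ℝ} (hc : c ^ 2 + t ^ 2 = 1) (ht : t ≠ 0)
    (hκ1 : κ < 1)
    (h : (c - κ * s) ^ 2 - 2 * (c - s) * (c - κ * s) + 1 = 0) : |c - κ * s| < 1 := by
  rw [← sq_lt_one_iff_abs_lt_one]
  have ht' : 0 < t ^ 2 := by positivity
  have h1 : t ^ 2 + 2 * (s * c) = κ * (2 - κ) * s ^ 2 := by linear_combination h + hc
  have h2 : (c - κ * s) ^ 2 = 1 - 2 * (1 - κ) * (κ * s ^ 2 - s * c) := by
    linear_combination -h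
  have h3 : 0 < κ * s ^ 2 - s * c := by nlinarith [mul_nonneg (sq_nonneg κ) (sq_nonneg s)]
  have h4 := mul_pos (sub_pos.2 hκ1) h3
  linarith

/-- The dispersion equation is 1 − g_1² + (g_1 − g_μ)² = 0, and g_1 − g_μ is proportional to 1 − μ;
this is where a = 1 − (1 − μ)² comes from. -/
theorem mem_pointSpectrum_iff_gapFun (hL : 0 < L) (hμ : 0 < μ) (hμ1 : μ < 1) (hω : ω ≠ 0)
    (hs : Real.sin ω ≠ 0) :
    ((ω ^ 2 : ℝ) : ℂ) ∈ pointSpectrum (ladderSymOp L μ) ↔ gapFun L (1 - (1 - μ) ^ 2) ω = 0 := by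
  have ha : 0 < 1 - (1 - μ) ^ 2 := by nlinarith
  by_cases hC : Real.cos (ω * L / 2) = 0
  · exact iff_of_false (notMem_pointSpectrum_of_cos_eq_zero hL hμ hω hs hC)
      fun h => cos_ne_zero_of_gapFun_eq_zero ha hs h hC
  have key : Real.sin ω * gapFun L (1 - (1 - μ) ^ 2) ω = 4 * Real.cos (ω * L / 2) ^ 2 *
      (vertexCoeff L μ ω ^ 2 - 2 * vertexCoeff L 1 ω * vertexCoeff L μ ω + 1) := by
    rw [vertexCoeff_eq, vertexCoeff_eq, gapFun]
    field_simp
    linear_combination (16 * Real.cos (ω * L / 2) ^ 2) * Real.sin_sq_add_cos_sq ω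
  have hC4 : 4 * Real.cos (ω * L / 2) ^ 2 ≠ 0 := by positivity
  constructor
  · intro h
    have h1 := (dispersion_of_mem_pointSpectrum hL hμ hω hs hC h).2
    rw [h1, mul_zero] at key
    exact (mul_eq_zero.1 key).resolve_left hs
  · intro h
    rw [h, mul_zero] at key
    have h1 := (mul_eq_zero.1 key.symm).resolve_left hC4
    refine mem_pointSpectrum_of_dispersion hL hμ hs hC ?_ h1
    simp only [vertexCoeff_eq, one_mul] at h1 ⊢
    exact dispersion_holds (Real.cos_sq_add_sin_sq ω) hs hμ1 h1

theorem modPi_eq {n : ℤ} (h1 : Real.pi * n < ω) (h2 : ω < Real.pi * (n + 1)) :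
    modPi ω = ω - Real.pi * n := by
  have : ⌊ω / Real.pi⌋ = n := by
    rw [Int.floor_eq_iff, le_div_iff₀ Real.pi_pos, div_lt_iff₀ Real.pi_pos]
    constructor <;> linarith
  rw [modPi, this]

/-- Trigonometric functions of `ω` in terms of the representative of `ω / 2` in `(0, π / 2)`. -/
theorem exists_half_angle {n : ℤ} (h1 : Real.pi * n < ω) (h2 : ω < Real.pi * (n + 1)) :
    ∃ ε s c : ℝ, ε ≠ 0 ∧ 0 < s ∧ 0 < c ∧ Real.tan (modPi ω / 2) = s / c ∧
      Real.sin ω = ε * (2 * s * c) ∧ Real.cos ω = ε * (c ^ 2 - s ^ 2) := by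
  have hpi := Real.pi_pos
  set θ := (ω - Real.pi * n) / 2 with hθ
  have hθ0 : 0 < θ := by linarith
  have hθ1 : θ < Real.pi / 2 := by linarith
  have hω : ω = 2 * θ + n * Real.pi := by rw [hθ]; ring
  refine ⟨(-1) ^ n, Real.sin θ, Real.cos θ, zpow_ne_zero _ (by norm_num),
    Real.sin_pos_of_pos_of_lt_pi hθ0 (by linarith), Real.cos_pos_of_mem_Ioo ⟨by linarith, hθ1⟩,
    ?_, ?_, ?_⟩
  · rw [modPi_eq h1 h2, ← hθ, Real.tan_eq_sin_div_cos]
  · rw [hω, Real.sin_add_int_mul_pi, Real.sin_two_mul]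
  · rw [hω, Real.cos_add_int_mul_pi, Real.cos_two_mul']

theorem sin_ne_zero_of_mem {n : ℤ} (h1 : Real.pi * n < ω) (h2 : ω < Real.pi * (n + 1)) :
    Real.sin ω ≠ 0 := by
  obtain ⟨ε, s, c, hε, hs, hc, -, h, -⟩ := exists_half_angle h1 h2
  rw [h]
  positivity

theorem phiL_eq (L ω : ℝ) :
    phiL L ω = 2 * (Real.cos (ω * L / 2) / Real.sin (ω * L / 2)) := by
  rw [phiL, Real.tan_eq_sin_div_cos, div_div_eq_mul_div, mul_div_assoc]

/-- Divided by sin ω sin²(ωL/2), `gapFun L 1` is φ² + 2φ cot ω − 1 = (φ − f⁺)(φ − f⁻), by 2 cot ω =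
cot(ω/2) − tan(ω/2). -/
theorem gapFun_eq_zero_of_fPlus {n : ℤ} (h1 : Real.pi * n < ω) (h2 : ω < Real.pi * (n + 1))
    (h : phiL L ω = fPlus ω) :
    0 < Real.sin (ω * L / 2) * Real.cos (ω * L / 2) ∧ gapFun L 1 ω = 0 := by
  obtain ⟨ε, s, c, hε, hs, hc, ht, hsin, hcos⟩ := exists_half_angle h1 h2
  rw [phiL_eq, fPlus, ht] at h
  -- At a pole `phiL` takes the default value 0, which differs from f⁺ > 0.
  have hS : Real.sin (ω * L / 2) ≠ 0 := by
    intro h0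
    rw [h0, div_zero, mul_zero] at h
    exact (div_pos hs hc).ne h
  have hφ : 0 < Real.cos (ω * L / 2) / Real.sin (ω * L / 2) := by
    have := div_pos hs hc
    linarith
  refine ⟨by rw [mul_div_sq_eq]; positivity, ?_⟩
  have h3 : 2 * Real.cos (ω * L / 2) * c = s * Real.sin (ω * L / 2) := by
    field_simp at h
    linarith
  rw [gapFun, hsin, hcos]
  apply mul_left_cancel₀ hc.ne'
  linear_combination (2 * ε * (2 * s * c * Real.cos (ω * L / 2)
    + c ^ 2 * Real.sin (ω * L / 2))) * h3

theorem gapFun_eq_zero_of_fMinus {n : ℤ} (h1 : Real.pi * n < ω) (h2 : ω < Real.pi * (n + 1))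
    (h : phiL L ω = fMinus ω) :
    Real.sin (ω * L / 2) * Real.cos (ω * L / 2) < 0 ∧ gapFun L 1 ω = 0 := by
  obtain ⟨ε, s, c, hε, hs, hc, ht, hsin, hcos⟩ := exists_half_angle h1 h2
  rw [phiL_eq, fMinus, ht, inv_div] at h
  have hpos := div_pos hc hs
  have hS : Real.sin (ω * L / 2) ≠ 0 := by
    intro h0
    rw [h0, div_zero, mul_zero] at h
    linarith
  have hφ : Real.cos (ω * L / 2) / Real.sin (ω * L / 2) < 0 := by linarith
  refine ⟨by rw [mul_div_sq_eq]; exact mul_neg_of_pos_of_neg (by positivity) hφ, ?_⟩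
  have h3 : 2 * Real.cos (ω * L / 2) * s = -(c * Real.sin (ω * L / 2)) := by
    field_simp at h
    linarith
  rw [gapFun, hsin, hcos]
  apply mul_left_cancel₀ hs.ne'
  linear_combination (2 * ε * (2 * s * c * Real.cos (ω * L / 2)
    - s ^ 2 * Real.sin (ω * L / 2))) * h3

end Bridge

/-! ### Eigenvalues in a gap. -/

section Main

variable {L μ : ℝ}

theorem phiL_nonpos {ω : ℝ} (h : phiL L ω ≤ 0) :
    Real.sin (ω * L / 2) * Real.cos (ω * L / 2) ≤ 0 := by
  rw [phiL_eq] at h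
  rw [mul_div_sq_eq]
  exact mul_nonpos_of_nonneg_of_nonpos (sq_nonneg _) (by linarith)

theorem phiL_nonneg {ω : ℝ} (h : 0 ≤ phiL L ω) :
    0 ≤ Real.sin (ω * L / 2) * Real.cos (ω * L / 2) := by
  rw [phiL_eq] at h
  rw [mul_div_sq_eq]
  exact mul_nonneg (sq_nonneg _) (by linarith)

/-- A set of squares of numbers in an interval. -/
theorem setOf_mem_Ioo_sq_eq {ωb ωt : ℝ} (hb : 0 ≤ ωb) (hbt : ωb < ωt) {p : ℝ → Prop} {s : Set ℝ}
    (hs : s ⊆ Ioo ωb ωt) (h : ∀ ω ∈ Ioo ωb ωt, p (ω ^ 2) ↔ ω ∈ s) :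
    {x : ℝ | x ∈ Ioo (ωb ^ 2) (ωt ^ 2) ∧ p x} = (fun ω => ω ^ 2) '' s := by
  ext x
  constructor
  · rintro ⟨hx, hp⟩
    have hx0 : 0 ≤ x := (sq_nonneg ωb).trans hx.1.le
    have h1 : ωb < Real.sqrt x := Real.lt_sqrt_of_sq_lt hx.1
    have h2 : Real.sqrt x < ωt := (Real.sqrt_lt' (hb.trans_lt hbt)).2 hx.2
    refine ⟨Real.sqrt x, (h _ ⟨h1, h2⟩).1 ?_, Real.sq_sqrt hx0⟩
    rwa [Real.sq_sqrt hx0]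
  · rintro ⟨ω, hω, rfl⟩
    have h1 := hs hω
    refine ⟨⟨?_, ?_⟩, (h ω h1).2 hω⟩
    · exact pow_lt_pow_left₀ h1.1 hb two_ne_zero
    · exact pow_lt_pow_left₀ h1.2 (hb.trans h1.1.le) two_ne_zero

/-- In a gap contained in `(π n, π (n + 1))` the eigenvalues are the squares of the zeros of
`gapFun`; they are simple and belong to the discrete spectrum. -/
theorem eigenvalues_in_gap (hL : 0 < L) (hμ : 0 < μ) (hμ1 : μ < 1) {ωb ωt : ℝ} (hb : 0 ≤ ωb)
    (hbt : ωb < ωt) (hgap : IsSpectralGap (ladderSymOp L μ) (ωb ^ 2) (ωt ^ 2))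
    (hsin : ∀ ω ∈ Ioo ωb ωt, Real.sin ω ≠ 0) {s : Set ℝ} (hs : s ⊆ Ioo ωb ωt)
    (h : ∀ ω ∈ Ioo ωb ωt, gapFun L (1 - (1 - μ) ^ 2) ω = 0 ↔ ω ∈ s) :
    {x : ℝ | x ∈ Ioo (ωb ^ 2) (ωt ^ 2) ∧ (x : ℂ) ∈ pointSpectrum (ladderSymOp L μ)}
        = (fun ω => ω ^ 2) '' s ∧
      {x : ℝ | x ∈ Ioo (ωb ^ 2) (ωt ^ 2) ∧ (x : ℂ) ∈ discreteSpectrum (ladderSymOp L μ)}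
        = (fun ω => ω ^ 2) '' s ∧
      ∀ ω ∈ s, IsSimpleEigenvalue (ladderSymOp L μ) ((ω ^ 2 : ℝ) : ℂ) := by
  have ha : 0 < 1 - (1 - μ) ^ 2 := by nlinarith
  have hmem : ∀ ω ∈ Ioo ωb ωt,
      ((ω ^ 2 : ℝ) : ℂ) ∈ pointSpectrum (ladderSymOp L μ) ↔ ω ∈ s := fun ω hω =>
    (mem_pointSpectrum_iff_gapFun hL hμ hμ1 (hb.trans_lt hω.1).ne' (hsin ω hω)).trans (h ω hω)
  have hpt := setOf_mem_Ioo_sq_eq hb hbt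
    (p := fun x => (x : ℂ) ∈ pointSpectrum (ladderSymOp L μ)) hs hmem
  refine ⟨hpt, ?_, fun ω hω => ?_⟩
  · rw [← hpt]
    ext x
    refine and_congr_right fun hx => ⟨fun hd => hd.2.2.1, fun hp => ?_⟩
    -- An eigenvalue that is not discrete would be essential by definition, which the gap excludes;
    -- isolation needs no separate proof.
    by_contra hd
    exact hgap.2.2.2 x hx ⟨pointSpectrum_subset_opSpectrum _ hp, hd⟩
  · have hω' := hs hω
    have h0 := (hb.trans_lt hω'.1).ne'
    exact isSimpleEigenvalue_of_mem_pointSpectrum hL hμ h0 (hsin ω hω')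
      (cos_ne_zero_of_gapFun_eq_zero ha (hsin ω hω') ((h ω hω').2 hω)) ((hmem ω hω').2 hω)

theorem gap_inequality (hL : 0 < L) (hμ : 0 < μ) {ωb ωt : ℝ} (hb : 0 ≤ ωb)
    (hgap : IsSpectralGap (ladderSymOp L μ) (ωb ^ 2) (ωt ^ 2))
    (hsin : ∀ ω ∈ Ioo ωb ωt, Real.sin ω ≠ 0) :
    ∀ ω ∈ Ioo ωb ωt, Real.sin ω * gapFun L 1 ω < 0 := fun ω hω =>
  sin_mul_gapFun_neg_of_notMem hL hμ (hb.trans_lt hω.1).ne' (hsin ω hω)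
    (hgap.2.2.2 _ ⟨pow_lt_pow_left₀ hω.1 hb two_ne_zero,
      pow_lt_pow_left₀ hω.2 (hb.trans hω.1.le) two_ne_zero⟩)

end Main

end

theorem theorem4p1 (L μ : ℝ) (hL : 0 < L) :
    (1 ≤ μ → discreteSpectrum (ladderSymOp L μ) = ∅) ∧
    (0 < μ → μ < 1 → ∀ ωb ωt : ℝ, 0 ≤ ωb → ωb < ωt →
      IsSpectralGap (ladderSymOp L μ) (ωb ^ 2) (ωt ^ 2) →
        (IsTypeI L ωb ωt →
          ∃ ω₁ ω₂ : ℝ, ωb < ω₁ ∧ ω₁ < ω₂ ∧ ω₂ < ωt ∧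
            {x : ℝ | x ∈ Ioo (ωb ^ 2) (ωt ^ 2) ∧ (x : ℂ) ∈ pointSpectrum (ladderSymOp L μ)}
              = {ω₁ ^ 2, ω₂ ^ 2} ∧
            {x : ℝ | x ∈ Ioo (ωb ^ 2) (ωt ^ 2) ∧ (x : ℂ) ∈ discreteSpectrum (ladderSymOp L μ)}
              = {ω₁ ^ 2, ω₂ ^ 2} ∧
            IsSimpleEigenvalue (ladderSymOp L μ) ((ω₁ ^ 2 : ℝ) : ℂ) ∧
            IsSimpleEigenvalue (ladderSymOp L μ) ((ω₂ ^ 2 : ℝ) : ℂ)) ∧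
        (IsTypeII L ωb ωt ∨ IsTypeIII L ωb ωt →
          ∃ ω₁ : ℝ, ωb < ω₁ ∧ ω₁ < ωt ∧
            {x : ℝ | x ∈ Ioo (ωb ^ 2) (ωt ^ 2) ∧ (x : ℂ) ∈ pointSpectrum (ladderSymOp L μ)}
              = {ω₁ ^ 2} ∧
            {x : ℝ | x ∈ Ioo (ωb ^ 2) (ωt ^ 2) ∧ (x : ℂ) ∈ discreteSpectrum (ladderSymOp L μ)}
              = {ω₁ ^ 2} ∧
            IsSimpleEigenvalue (ladderSymOp L μ) ((ω₁ ^ 2 : ℝ) : ℂ))) := by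
  refine ⟨discreteSpectrum_eq_empty hL, fun hμ hμ1 ωb ωt hb hbt hgap => ?_⟩
  -- The parameter a = μ(2 − μ) lies strictly between 0 and 1 because 0 < μ < 1.
  have ha : 0 < 1 - (1 - μ) ^ 2 := by nlinarith
  have ha1 : 1 - (1 - μ) ^ 2 < 1 := by nlinarith [sub_pos.2 hμ1]
  have hsinI : ∀ n : ℤ, Real.pi * n ≤ ωb → ωt ≤ Real.pi * (n + 1) →
      ∀ ω ∈ Ioo ωb ωt, Real.sin ω ≠ 0 := fun n h1 h2 ω hω =>
    sin_ne_zero_of_mem (h1.trans_lt hω.1) (hω.2.trans_le h2)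
  constructor
  · rintro ⟨n, h1, -, h2, h3, h4⟩
    have hsin := hsinI n h1.le h2.le
    have hb2 : ωb < Real.pi * (n + 1) := hbt.trans h2
    have ht1 : Real.pi * n < ωt := h1.trans hbt
    obtain ⟨k1, k2⟩ := gapFun_eq_zero_of_fPlus h1 hb2 h3
    obtain ⟨k3, k4⟩ := gapFun_eq_zero_of_fMinus ht1 h2 h4
    obtain ⟨x, y, hx, hxy, hy, hz⟩ := gapFun_zeros_of_two_branches hL ha ha1 hbt
      (gap_inequality hL hμ hb hgap hsin) (sin_ne_zero_of_mem h1 hb2)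
      (sin_ne_zero_of_mem ht1 h2) k1 k2 k3 k4
    have hsub : ({x, y} : Set ℝ) ⊆ Ioo ωb ωt := by
      rintro w (rfl | rfl)
      · exact ⟨hx, hxy.trans hy⟩
      · exact ⟨hx.trans hxy, hy⟩
    obtain ⟨e1, e2, e3⟩ := eigenvalues_in_gap hL hμ hμ1 hb hbt hgap hsin hsub hz
    rw [image_pair] at e1 e2
    exact ⟨x, y, hx, hxy, hy, e1, e2, e3 x (by simp), e3 y (by simp)⟩
  · intro htype
    obtain ⟨x, hx, hxt, hsin, hz⟩ : ∃ x, ωb < x ∧ x < ωt ∧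
        (∀ ω ∈ Ioo ωb ωt, Real.sin ω ≠ 0) ∧
        ∀ ω ∈ Ioo ωb ωt, gapFun L (1 - (1 - μ) ^ 2) ω = 0 ↔ ω = x := by
      rcases htype with ⟨n, h1, -, h2, h3, h4⟩ | ⟨n, h1, -, h2, h3, h4⟩
      · have hsin := hsinI n h1.le h2.le
        have ht1 : Real.pi * n < ωt := h1.trans_lt hbt
        obtain ⟨k3, k4⟩ := gapFun_eq_zero_of_fMinus ht1 h2 h4
        obtain ⟨x, hx, hxt, hz⟩ := gapFun_zero_of_left_degenerate hL ha ha1 hbt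
          (gap_inequality hL hμ hb hgap hsin) (by rw [← h1, mul_comm, Real.sin_int_mul_pi])
          (sin_ne_zero_of_mem ht1 h2) (phiL_nonpos h3) k3 k4
        exact ⟨x, hx, hxt, hsin, hz⟩
      · have hsin := hsinI n h1.le h2.le
        have hb2 : ωb < Real.pi * (n + 1) := h2 ▸ hbt
        obtain ⟨k1, k2⟩ := gapFun_eq_zero_of_fPlus h1 hb2 h3
        obtain ⟨x, hx, hxt, hz⟩ := gapFun_zero_of_right_degenerate hL ha ha1 hbt
          (gap_inequality hL hμ hb hgap hsin) (sin_ne_zero_of_mem h1 hb2)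
          (by
            have := Real.sin_int_mul_pi (n + 1)
            push_cast at this
            rw [h2, mul_comm, this]) k1 k2 (phiL_nonneg h4)
        exact ⟨x, hx, hxt, hsin, hz⟩
    have hsub : ({x} : Set ℝ) ⊆ Ioo ωb ωt := singleton_subset_iff.2 ⟨hx, hxt⟩
    obtain ⟨e1, e2, e3⟩ := eigenvalues_in_gap hL hμ hμ1 hb hbt hgap hsin hsub hz
    rw [image_singleton] at e1 e2
    exact ⟨x, hx, hxt, e1, e2, e3 x rfl⟩
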